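/- Let $K$ be a complete discrete valuation field with valuation ring $R$ and perfect residue field $k$, and let $\ell$ be a prime number different from the characteristic of $k$. Assume that no finite extension of $k$ contains all the roots of unity of $\ell$-power order. Let $K^{sep}$ be a separable closure of $K$, let $G_K=\mathrm{Gal}(K^{sep}/K)$ with its Krull topology, and let $I_K\subset G_K$ be the inertia group, i.e. the group of all $\sigma\in G_K$ that act trivially modulo the maximal ideal of the integral closure of $R$ in $K^{sep}$; it carries the subspace topology. Let $\rho$ be an $\ell$-adic representation of $G_K$, i.e. a continuous linear representation of $G_K$ on a finite-dimensional $\mathbb{Q}_\ell$-vector space $V$, and let $d=\dim_{\mathbb{Q}_\ell}V\ge 0$. Put $C_{\ell,d}=|GL_d(\mathbb{F}_\ell)|$ if $\ell\neq 2$ and $C_{2,d}=|GL_d(\mathbb{Z}/4\mathbb{Z})|$. Then the two subsets $\{s\in I_K \mid \rho(s)\text{ is unipotent}\}$ and $\{s\in I_K\mid \mathrm{Tr}(\rho(s);V)=d\}$ of $I_K$ are equal. This subset $I$ is an open subgroup of $I_K$, and its index $[I_K:I]$ is finite and divides $C_{\ell,d}$. -/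

import Mathlib

universe u

/-- Condition `(C_ℓ)` on a field `k` (used for `ℓ` a prime different from the characteristic):
no finite extension of `k` contains all the roots of unity of `ℓ`-power order, i.e. no finite
extension contains a primitive `ℓ ^ n`-th root of unity for every `n`. -/
def ConditionC (ℓ : ℕ) (k : Type u) [Field k] : Prop :=
  ∀ (k' : Type u) [Field k'] [Algebra k k'] [FiniteDimensional k k'],
    ¬ ∀ n : ℕ, ∃ ζ : k', IsPrimitiveRoot ζ (ℓ ^ n)

/-- The inertia group of `Gal(L/K)` at an ideal `M` of the integral closure of `R` in `L`: the
automorphisms `σ` such that `σ x ≡ x` modulo `M` for every `x ∈ L` that is integral over `R`. For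
`R` a complete discrete valuation ring with fraction field `K`, and `L = K^sep`, the integral
closure has exactly one maximal ideal `M` and this is the inertia group `I_K`. -/
def inertiaGroup (R K L : Type*) [CommRing R] [Field K] [Field L] [Algebra R K] [Algebra R L]
    [Algebra K L] [IsScalarTower R K L] (M : Ideal (integralClosure R L)) :
    Subgroup Gal(L/K) :=
  M.inertia Gal(L/K)

/-- A linear endomorphism is unipotent if it differs from the identity by a nilpotent one. -/
def IsUnipotentEnd {F V : Type*} [Field F] [AddCommGroup V] [Module F V]
    (f : Module.End F V) : Prop :=
  IsNilpotent (f - 1)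

/-- The constant `C_{ℓ, d}`: the order of `GL_d(𝔽_ℓ)` if `ℓ ≠ 2`, of `GL_d(ℤ/4ℤ)` if `ℓ = 2`. -/
noncomputable def monodromyBound (ℓ d : ℕ) : ℕ :=
  if ℓ = 2 then Nat.card (GL (Fin d) (ZMod 4)) else Nat.card (GL (Fin d) (ZMod ℓ))

/-!
Grothendieck's argument. A lattice stable under the compact group `Gal(Ksep/K)` turns `ρ` into a
homomorphism `r` into matrices over `ℤ_ℓ` (`exists_basis_toMatrix_eq_map`). Let `H'` be the
subgroup of those `h` in the inertia group with `r h ≡ 1` modulo `q`, where `q = ℓ` for odd `ℓ` and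
`q = 4` for `ℓ = 2`. Its index divides `monodromyBound ℓ d`, so it suffices to show that `H'` acts
unipotently and to deduce the rest from that.

The arithmetic input is the tame relation `mul_mem_of_tame`: in each finite quotient in which
`H'` becomes an `ℓ`-group, `g h g⁻¹ = h ^ χ(g)` for `h ∈ H'`, where `χ` is the cyclotomic character.
It is proved with the tame character `σ ↦ σ ϖ / ϖ` modulo `M` for a uniformizer `ϖ` of a finite
Galois extension; this character detects inertia elements of order prime to the residue
characteristic (`eq_self_of_sub_mem_maximalIdeal`), and completeness of `R` makes the maximal ideal
`M` stable under the Galois group (`smul_mem_of_isMaximal`). In the limit `r h` is conjugate to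
`(r h) ^ χ(g)`, so the logarithm of `r h` is conjugate to its multiple by `χ(g)`. By `ConditionC`
no power of `χ` is trivial (`exists_cyclotomicCharacter_pow_ne_one`), which forces the
characteristic polynomial of the logarithm to be `X ^ d` and `r h` to be unipotent
(`isNilpotent_sub_one_of_conj_eq_pow`).

As inertia fixes the roots of unity of `ℓ`-power order, the tame relation also shows that the
image of `H'` commutes with the image of inertia (`commute_of_mem_ker`). A unipotent element is a
polynomial in each of its positive powers, so every inertia element acting unipotently commutes
with the image of inertia, and these elements form a subgroup containing `H'`
(`unipotentSubgroup`). Finally, each inertia element has a positive power in `H'`, so its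
eigenvalues are roots of unity; `d` roots of unity with sum `d` are all equal to `1`, hence trace
`d` characterises unipotence (`isNilpotent_sub_one_of_trace_eq_finrank`).
-/

/-! ### Powers of an `ℓ`-adic matrix close to the identity -/

lemma exists_one_add_prime_pow_mul_pow_prime {S : Type*} [CommRing S] {ℓ : ℕ} (hℓ : ℓ.Prime)
    {m : ℕ} (hm : 1 ≤ m) (hm2 : ℓ = 2 → 2 ≤ m) (y : S) :
    ∃ w : S, (1 + (ℓ : S) ^ m * y) ^ ℓ = 1 + (ℓ : S) ^ (m + 1) * (y * (1 + ℓ * w)) := by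
  suffices h : ∃ w : S, ∑ i ∈ Finset.range ℓ, (1 + (ℓ : S) ^ m * y) ^ i = ℓ * (1 + ℓ * w) by
    obtain ⟨w, hw⟩ := h
    refine ⟨w, ?_⟩
    have := mul_geom_sum (1 + (ℓ : S) ^ m * y) ℓ
    rw [hw] at this
    linear_combination -this
  obtain ⟨k, rfl⟩ := Nat.exists_eq_add_of_le' hm
  rcases hℓ.eq_two_or_odd' with rfl | hodd
  · obtain ⟨j, rfl⟩ : ∃ j, k = j + 1 := ⟨k - 1, by have := hm2 rfl; omega⟩
    refine ⟨2 ^ j * y, ?_⟩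
    simp only [Finset.sum_range_succ, Finset.sum_range_zero]
    push_cast
    ring
  · obtain ⟨s, hs⟩ : ∃ s : ℕ → S, ∀ i, (1 + (ℓ : S) ^ (k + 1) * y) ^ i =
        1 ^ i + i * 1 ^ (i - 1) * ((ℓ : S) ^ (k + 1) * y) + s i * ((ℓ : S) ^ (k + 1) * y) ^ 2 :=
      ⟨_, fun i ↦ (Polynomial.powAddExpansion (1 : S) ((ℓ : S) ^ (k + 1) * y) i).2⟩
    obtain ⟨r, hr⟩ := hodd
    have hsum : (∑ i ∈ Finset.range ℓ, (i : S)) = ℓ * r := by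
      have h1 : ∑ i ∈ Finset.range ℓ, i = ℓ * r := by
        have := Finset.sum_range_id_mul_two ℓ
        rw [hr] at this ⊢
        simp only [Nat.add_sub_cancel] at this
        linarith
      rw [← Nat.cast_sum, h1, Nat.cast_mul]
    refine ⟨r * (ℓ : S) ^ k * y + (ℓ : S) ^ (2 * k) * y ^ 2 * ∑ i ∈ Finset.range ℓ, s i, ?_⟩
    have : ∀ i, (1 + (ℓ : S) ^ (k + 1) * y) ^ i =
        1 + i * ((ℓ : S) ^ (k + 1) * y) + s i * ((ℓ : S) ^ (k + 1) * y) ^ 2 := by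
      intro i
      rw [hs i]
      simp
    rw [Finset.sum_congr rfl fun i _ ↦ this i, Finset.sum_add_distrib, Finset.sum_add_distrib,
      ← Finset.sum_mul, ← Finset.sum_mul, hsum]
    simp only [Finset.sum_const, Finset.card_range, nsmul_eq_mul, mul_one]
    ring

lemma exists_one_add_prime_pow_mul_pow_prime_pow {S : Type*} [CommRing S] {ℓ : ℕ} (hℓ : ℓ.Prime)
    {c : ℕ} (hc : 1 ≤ c) (hc2 : ℓ = 2 → 2 ≤ c) (y : S) (n : ℕ) :
    ∃ w : S, (1 + (ℓ : S) ^ c * y) ^ ℓ ^ n = 1 + (ℓ : S) ^ (c + n) * (y * (1 + ℓ * w)) := by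
  induction n with
  | zero => exact ⟨0, by simp⟩
  | succ n ih =>
    obtain ⟨w, hw⟩ := ih
    obtain ⟨w', hw'⟩ := exists_one_add_prime_pow_mul_pow_prime hℓ (m := c + n) (by omega)
      (fun h ↦ by have := hc2 h; omega) (y * (1 + ℓ * w))
    refine ⟨w + w' + ℓ * w * w', ?_⟩
    rw [pow_succ, pow_mul, hw, hw', ← add_assoc]
    ring

/-- If `A = 1 + ℓ ^ c * B` with `c ≥ 1` (`c ≥ 2` when `ℓ = 2`), then `(A ^ ℓ ^ n - 1) / ℓ ^ n` is
`A - 1` times a factor congruent to `1` modulo `ℓ` and commuting with `A`. -/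
lemma exists_commute_one_add_pow_prime_pow {S : Type*} [Ring S] {ℓ : ℕ} (hℓ : ℓ.Prime)
    {c : ℕ} (hc : 1 ≤ c) (hc2 : ℓ = 2 → 2 ≤ c) (B : S) (n : ℕ) :
    ∃ W : S, Commute B W ∧
      (1 + (ℓ : S) ^ c * B) ^ ℓ ^ n =
        1 + (ℓ : S) ^ n * (((ℓ : S) ^ c * B) * (1 + ℓ * W)) := by
  obtain ⟨w, hw⟩ := exists_one_add_prime_pow_mul_pow_prime_pow hℓ hc hc2
    (Polynomial.X : Polynomial ℤ) n
  refine ⟨Polynomial.aeval B w, ?_, ?_⟩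
  · have := (Commute.all (Polynomial.X : Polynomial ℤ) w).map (Polynomial.aeval B)
    simpa using this
  · have := congrArg (Polynomial.aeval B) hw
    simp only [map_pow, map_add, map_one, map_mul, map_natCast, Polynomial.aeval_X] at this
    rw [this, pow_add]
    have h : (ℓ : S) ^ c * (ℓ : S) ^ n = (ℓ : S) ^ n * (ℓ : S) ^ c := by
      rw [← pow_add, ← pow_add, add_comm]
    rw [h]
    simp only [mul_assoc]

section Matrix

open Polynomial Matrix

variable {d : ℕ}

lemma charpoly_smul_comp {S : Type*} [CommRing S] (a : S) (Y : Matrix (Fin d) (Fin d) S) :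
    (a • Y).charpoly.comp (C a * X) = C (a ^ d) * Y.charpoly := by
  have h1 : (a • Y).charpoly.comp (C a * X) =
      ((compRingHom (C a * X : S[X])).mapMatrix (charmatrix (a • Y))).det := by
    rw [← RingHom.map_det]; rfl
  have h2 : (compRingHom (C a * X : S[X])).mapMatrix (charmatrix (a • Y)) =
      C a • charmatrix Y := by
    ext1 i j
    by_cases hij : i = j
    · subst hij
      simp [charmatrix_apply_eq, mul_sub]
    · simp [charmatrix_apply_ne _ _ _ hij]
  rw [h1, h2, det_smul]
  simp [charpoly]

/-- A matrix over a domain that is conjugate to its multiple by `u i`, for units `u i` with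
`u i ^ i ≠ 1` for each `i ≥ 1`, is nilpotent: its characteristic polynomial is `X ^ d`. -/
lemma isNilpotent_of_conj_eq_smul {S : Type*} [CommRing S] [IsDomain S]
    (Y : Matrix (Fin d) (Fin d) S)
    (h : ∀ i : ℕ, 1 ≤ i → ∃ (P : (Matrix (Fin d) (Fin d) S)ˣ) (u : Sˣ), u ^ i ≠ 1 ∧
      P.val * Y * P⁻¹.val = (u : S) • Y) : IsNilpotent Y := by
  have hchar : Y.charpoly = X ^ d := by
    ext i
    rw [coeff_X_pow]
    have hdeg : Y.charpoly.natDegree = d := by simp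
    rcases lt_trichotomy i d with hi | rfl | hi
    · rw [if_neg hi.ne]
      obtain ⟨P, u, hu, hP⟩ := h (d - i) (by omega)
      have h1 := charpoly_smul_comp (u : S) Y
      rw [← hP, Matrix.coe_units_inv, Matrix.charpoly_units_conj] at h1
      have h2 := congrArg (fun p ↦ p.coeff i) h1
      simp only [comp_C_mul_X_coeff, coeff_C_mul] at h2
      have h3 : Y.charpoly.coeff i * (u : S) ^ i * (1 - (u : S) ^ (d - i)) = 0 := by
        have : (u : S) ^ d = (u : S) ^ i * (u : S) ^ (d - i) := by
          rw [← pow_add]; congr 1; omega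
        rw [this] at h2
        linear_combination h2
      have h4 : (1 - (u : S) ^ (d - i)) ≠ 0 := by
        intro h0
        apply hu
        ext
        push_cast
        exact (sub_eq_zero.mp h0).symm
      have h5 : (u : S) ^ i ≠ 0 := (u.isUnit.pow i).ne_zero
      simpa [h4, h5] using h3
    · rw [if_pos rfl]
      have := Y.charpoly_monic.coeff_natDegree
      rwa [hdeg] at this
    · rw [if_neg hi.ne']
      exact coeff_eq_zero_of_natDegree_lt (by omega)
  refine ⟨d, ?_⟩
  have := Y.aeval_self_charpoly
  rwa [hchar, map_pow, aeval_X] at this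

variable {ℓ : ℕ} [Fact ℓ.Prime]

lemma mapMatrix_toZModPow_eq_iff (n : ℕ) (A B : Matrix (Fin d) (Fin d) ℤ_[ℓ]) :
    (PadicInt.toZModPow n).mapMatrix A = (PadicInt.toZModPow n).mapMatrix B ↔
      ∃ C : Matrix (Fin d) (Fin d) ℤ_[ℓ], A = B + (ℓ : Matrix (Fin d) (Fin d) ℤ_[ℓ]) ^ n * C := by
  have hs : ∀ C : Matrix (Fin d) (Fin d) ℤ_[ℓ],
      (ℓ : Matrix (Fin d) (Fin d) ℤ_[ℓ]) ^ n * C = (ℓ : ℤ_[ℓ]) ^ n • C := by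
    intro C
    rw [← Nat.cast_pow, ← nsmul_eq_mul, ← Nat.cast_pow, Nat.cast_smul_eq_nsmul]
  simp only [hs]
  constructor
  · intro h
    have h1 : ∀ i j, ∃ x : ℤ_[ℓ], A i j = B i j + (ℓ : ℤ_[ℓ]) ^ n * x := by
      intro i j
      have := congrFun (congrFun h i) j
      simp only [RingHom.mapMatrix_apply, map_apply] at this
      rw [← sub_eq_zero, ← map_sub, ← RingHom.mem_ker, PadicInt.ker_toZModPow,
        Ideal.mem_span_singleton'] at this
      obtain ⟨x, hx⟩ := this
      exact ⟨x, by linear_combination -hx⟩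
    choose x hx using h1
    exact ⟨Matrix.of x, by ext1 i j; simp [hx]⟩
  · rintro ⟨C, rfl⟩
    ext1 i j
    simp only [RingHom.mapMatrix_apply, map_apply, Matrix.add_apply, Matrix.smul_apply,
      smul_eq_mul, map_add, map_mul, map_pow]
    have : (PadicInt.toZModPow n) (ℓ : ℤ_[ℓ]) ^ n = 0 := by
      rw [← map_pow, ← RingHom.mem_ker, PadicInt.ker_toZModPow]
      exact Ideal.mem_span_singleton_self _
    rw [this, zero_mul, add_zero]

lemma exists_one_add_pow_eq {S : Type*} [Ring S] (x : S) (a : ℕ) :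
    ∃ s : S, (1 + x) ^ a = 1 + a * x + x ^ 2 * s := by
  have h := (Polynomial.powAddExpansion (1 : Polynomial ℤ) Polynomial.X a).2
  refine ⟨Polynomial.aeval x (Polynomial.powAddExpansion (1 : Polynomial ℤ) Polynomial.X a).1, ?_⟩
  rw [mul_comm _ (Polynomial.X ^ 2)] at h
  simpa using congrArg (Polynomial.aeval x) h

lemma exists_conj_sub_smul_eq (A Z : Matrix (Fin d) (Fin d) ℤ_[ℓ]) (n : ℕ)
    (hZ : A ^ ℓ ^ n = 1 + (ℓ : Matrix (Fin d) (Fin d) ℤ_[ℓ]) ^ n * Z)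
    (P : (Matrix (Fin d) (Fin d) ℤ_[ℓ])ˣ) (u : ℤ_[ℓ])
    (hP : (PadicInt.toZModPow (2 * n)).mapMatrix (P.val * A * P⁻¹.val) =
        (PadicInt.toZModPow (2 * n)).mapMatrix (A ^ (PadicInt.toZModPow (2 * n) u).val)) :
    ∃ C : Matrix (Fin d) (Fin d) ℤ_[ℓ], P.val * Z * P⁻¹.val - u • Z = (ℓ : ℤ_[ℓ]) ^ n • C := by
  set a := (PadicInt.toZModPow (2 * n) u).val with ha
  have hs : ∀ (k : ℕ) (C : Matrix (Fin d) (Fin d) ℤ_[ℓ]),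
      (ℓ : Matrix (Fin d) (Fin d) ℤ_[ℓ]) ^ k * C = (ℓ : ℤ_[ℓ]) ^ k • C := by
    intro k C
    rw [← Nat.cast_pow, ← nsmul_eq_mul, ← Nat.cast_pow, Nat.cast_smul_eq_nsmul]
  obtain ⟨x, hx⟩ : ∃ x : ℤ_[ℓ], u = a + (ℓ : ℤ_[ℓ]) ^ (2 * n) * x := by
    have : u - a ∈ RingHom.ker (PadicInt.toZModPow (2 * n) : ℤ_[ℓ] →+* _) := by
      rw [RingHom.mem_ker, map_sub, map_natCast, ha, ZMod.natCast_zmod_val, sub_self]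
    rw [PadicInt.ker_toZModPow, Ideal.mem_span_singleton'] at this
    obtain ⟨x, hx⟩ := this
    exact ⟨x, by linear_combination -hx⟩
  have h1 : (PadicInt.toZModPow (2 * n)).mapMatrix (P.val * A ^ ℓ ^ n * P⁻¹.val) =
      (PadicInt.toZModPow (2 * n)).mapMatrix ((A ^ ℓ ^ n) ^ a) := by
    rw [← Units.conj_pow, map_pow, hP, ← map_pow, ← pow_mul, ← pow_mul, mul_comm a]
  obtain ⟨C, hC⟩ := (mapMatrix_toZModPow_eq_iff _ _ _).mp h1
  obtain ⟨s, hs'⟩ := exists_one_add_pow_eq ((ℓ : ℤ_[ℓ]) ^ n • Z) a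
  rw [hZ, hs, hs, hs', mul_add, add_mul, mul_one, Units.mul_inv] at hC
  refine ⟨Z ^ 2 * s + C - (ℓ : ℤ_[ℓ]) ^ n • x • Z, ?_⟩
  have hinj : Function.Injective fun X : Matrix (Fin d) (Fin d) ℤ_[ℓ] ↦ (ℓ : ℤ_[ℓ]) ^ n • X :=
    smul_right_injective _ (pow_ne_zero _ (by exact_mod_cast (Fact.out : ℓ.Prime).ne_zero))
  apply hinj
  have ha' : (a : Matrix (Fin d) (Fin d) ℤ_[ℓ]) * (ℓ : ℤ_[ℓ]) ^ n • Z =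
      (ℓ : ℤ_[ℓ]) ^ n • (a : ℤ_[ℓ]) • Z := by
    rw [← nsmul_eq_mul, smul_comm, Nat.cast_smul_eq_nsmul]
  rw [ha', Matrix.mul_smul, Matrix.smul_mul, _root_.smul_pow, Matrix.smul_mul] at hC
  show (ℓ : ℤ_[ℓ]) ^ n • _ = (ℓ : ℤ_[ℓ]) ^ n • _
  rw [hx]
  linear_combination (norm := module) (1 : ℤ_[ℓ]) • hC

/-- A matrix `A` over `ℤ_ℓ`, close to the identity and conjugate to `A ^ u` for sufficiently many
`ℓ`-adic units `u`, is unipotent. A limit point `Y` of `(A ^ ℓ ^ n - 1) / ℓ ^ n` plays the role of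
the logarithm of `A`: it is `A - 1` times an invertible matrix commuting with `A`, and it is
conjugate to `u • Y`. -/
theorem isNilpotent_sub_one_of_conj_eq_pow {c : ℕ} (hc : 1 ≤ c) (hc2 : ℓ = 2 → 2 ≤ c)
    (A : Matrix (Fin d) (Fin d) ℤ_[ℓ])
    (hA : (PadicInt.toZModPow c).mapMatrix A = 1)
    (h : ∀ i : ℕ, 1 ≤ i → ∃ (P : (Matrix (Fin d) (Fin d) ℤ_[ℓ])ˣ) (u : ℤ_[ℓ]ˣ), u ^ i ≠ 1 ∧
      ∀ n, (PadicInt.toZModPow n).mapMatrix (P.val * A * P⁻¹.val) =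
        (PadicInt.toZModPow n).mapMatrix (A ^ (PadicInt.toZModPow n (u : ℤ_[ℓ])).val)) :
    IsNilpotent (A - 1) := by
  have hp : ℓ.Prime := Fact.out
  rw [← map_one (PadicInt.toZModPow c).mapMatrix, mapMatrix_toZModPow_eq_iff] at hA
  obtain ⟨B, hB⟩ := hA
  choose W hWB hW using fun n ↦ exists_commute_one_add_pow_prime_pow hp hc hc2 B n
  rw [← hB] at hW
  set T := (ℓ : Matrix (Fin d) (Fin d) ℤ_[ℓ]) ^ c * B with hT
  have hcl : ∀ (M : Matrix (Fin d) (Fin d) ℤ_[ℓ]) (k : ℕ),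
      Commute ((ℓ : Matrix (Fin d) (Fin d) ℤ_[ℓ]) ^ k) M := fun M k ↦
    (Nat.cast_commute ℓ M).pow_left k
  -- a limit point of the sequence of correction factors
  obtain ⟨F, W₀, hF, hlim⟩ : ∃ (F : Ultrafilter ℕ) (W₀ : Matrix (Fin d) (Fin d) ℤ_[ℓ]),
      (F : Filter ℕ) ≤ Filter.atTop ∧ Filter.Tendsto W F (nhds W₀) := by
    have : CompactSpace (Matrix (Fin d) (Fin d) ℤ_[ℓ]) :=
      inferInstanceAs (CompactSpace (Fin d → Fin d → ℤ_[ℓ]))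
    obtain ⟨W₀, -, h0⟩ := isCompact_univ.ultrafilter_le_nhds
      ((Ultrafilter.of (Filter.atTop : Filter ℕ)).map W) (by simp)
    exact ⟨Ultrafilter.of Filter.atTop, W₀, Ultrafilter.of_le _, h0⟩
  have hcomm : Commute T (1 + (ℓ : Matrix (Fin d) (Fin d) ℤ_[ℓ]) * W₀) := by
    have hBW : Commute B W₀ := by
      have h1 : Filter.Tendsto (fun n ↦ B * W n) F (nhds (B * W₀)) := hlim.const_mul B
      have h2 : Filter.Tendsto (fun n ↦ W n * B) F (nhds (W₀ * B)) := hlim.mul_const B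
      exact tendsto_nhds_unique h1 (h2.congr fun n ↦ (hWB n).eq.symm)
    have hTW : Commute T W₀ := ((hcl W₀ c).mul_left hBW)
    exact (Commute.one_right _).add_right ((Nat.commute_cast T ℓ).mul_right hTW)
  have hdet : (1 + (ℓ : Matrix (Fin d) (Fin d) ℤ_[ℓ]) * W₀).det ≠ 0 := by
    intro h0
    have h1 : (PadicInt.toZModPow 1).mapMatrix (1 + (ℓ : Matrix (Fin d) (Fin d) ℤ_[ℓ]) * W₀) =
        (PadicInt.toZModPow 1).mapMatrix 1 :=
      (mapMatrix_toZModPow_eq_iff 1 _ _).mpr ⟨W₀, by rw [pow_one]⟩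
    have h2 := congrArg Matrix.det h1
    rw [← RingHom.map_det, ← RingHom.map_det, h0, det_one, map_zero, map_one] at h2
    have : Fact (1 < ℓ ^ 1) := ⟨by simpa using hp.one_lt⟩
    exact zero_ne_one h2
  -- `Y` is the substitute for the logarithm of `A`
  set Y := T * (1 + (ℓ : Matrix (Fin d) (Fin d) ℤ_[ℓ]) * W₀) with hY
  have hYlim : Filter.Tendsto (fun n ↦ T * (1 + (ℓ : Matrix (Fin d) (Fin d) ℤ_[ℓ]) * W n)) F
      (nhds Y) := ((hlim.const_mul _).const_add 1).const_mul T
  have hYnil : IsNilpotent Y := by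
    refine isNilpotent_of_conj_eq_smul Y fun i hi ↦ ?_
    obtain ⟨P, u, hu, hP⟩ := h i hi
    refine ⟨P, u, hu, ?_⟩
    have key : ∀ n, ∃ C : Matrix (Fin d) (Fin d) ℤ_[ℓ],
        P.val * (T * (1 + (ℓ : Matrix (Fin d) (Fin d) ℤ_[ℓ]) * W n)) * P⁻¹.val -
          (u : ℤ_[ℓ]) • (T * (1 + (ℓ : Matrix (Fin d) (Fin d) ℤ_[ℓ]) * W n)) =
          (ℓ : ℤ_[ℓ]) ^ n • C := fun n ↦ exists_conj_sub_smul_eq A _ n (hW n) P u (hP _)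
    have h1 : Filter.Tendsto (fun n ↦
        P.val * (T * (1 + (ℓ : Matrix (Fin d) (Fin d) ℤ_[ℓ]) * W n)) * P⁻¹.val -
          (u : ℤ_[ℓ]) • (T * (1 + (ℓ : Matrix (Fin d) (Fin d) ℤ_[ℓ]) * W n))) F
        (nhds (P.val * Y * P⁻¹.val - (u : ℤ_[ℓ]) • Y)) :=
      ((hYlim.const_mul _).mul_const _).sub (hYlim.const_smul _)
    have h2 : Filter.Tendsto (fun n ↦
        P.val * (T * (1 + (ℓ : Matrix (Fin d) (Fin d) ℤ_[ℓ]) * W n)) * P⁻¹.val -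
          (u : ℤ_[ℓ]) • (T * (1 + (ℓ : Matrix (Fin d) (Fin d) ℤ_[ℓ]) * W n))) F (nhds 0) := by
      choose C hC using key
      simp only [hC]
      refine tendsto_pi_nhds.mpr fun i ↦ tendsto_pi_nhds.mpr fun j ↦ ?_
      have h3 : Filter.Tendsto (fun n : ℕ ↦ (ℓ : ℤ_[ℓ]) ^ n) Filter.atTop (nhds 0) := by
        apply tendsto_pow_atTop_nhds_zero_of_norm_lt_one
        exact PadicInt.norm_lt_one_iff_dvd _ |>.mpr dvd_rfl
      refine squeeze_zero_norm (a := fun n ↦ ‖(ℓ : ℤ_[ℓ]) ^ n‖) (fun n ↦ ?_) ?_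
      · simp only [Matrix.smul_apply, smul_eq_mul, norm_mul]
        exact mul_le_of_le_one_right (norm_nonneg _) (PadicInt.norm_le_one _)
      · simpa using (h3.mono_left hF).norm
    exact sub_eq_zero.mp (tendsto_nhds_unique h1 h2)
  obtain ⟨k, hk⟩ := hYnil
  refine ⟨k, ?_⟩
  rw [hB, add_sub_cancel_left]
  rw [hY, hcomm.mul_pow] at hk
  have hdet' : ((1 + (ℓ : Matrix (Fin d) (Fin d) ℤ_[ℓ]) * W₀) ^ k).det ≠ 0 := by
    rw [det_pow]; exact pow_ne_zero _ hdet
  have h3 := congrArg (· * ((1 + (ℓ : Matrix (Fin d) (Fin d) ℤ_[ℓ]) * W₀) ^ k).adjugate) hk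
  simp only [mul_assoc, mul_adjugate, zero_mul, Matrix.mul_smul, mul_one] at h3
  exact (smul_eq_zero.mp h3).resolve_left hdet'

end Matrix

/-! ### Unipotent elements and finite-index central subgroups -/

section Unipotent

open Polynomial

/-- In characteristic zero a unipotent element is a polynomial in each of its positive powers. -/
lemma exists_aeval_pow_eq_of_isNilpotent_sub_one {F E : Type*} [Field F] [CharZero F] [Ring E]
    [Algebra F E] {a : E} (ha : IsNilpotent (a - 1)) {n : ℕ} (hn : n ≠ 0) :
    ∃ p : F[X], aeval (a ^ n) p = a := by
  have key : ∀ k : ℕ, ∃ p r : F[X], p.comp (X ^ n) - X = (X - 1) ^ k * r := by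
    intro k
    induction k with
    | zero => exact ⟨0, -X, by simp⟩
    | succ k ih =>
      obtain ⟨p, r, hr⟩ := ih
      set s : F[X] := ∑ i ∈ Finset.range n, X ^ i with hs
      have hs1 : s.eval 1 = n := by simp [hs, eval_finsetSum]
      have hX : (X : F[X]) ^ n - 1 = (X - 1) * s := (mul_geom_sum X n).symm
      have hn' : (n : F) ≠ 0 := Nat.cast_ne_zero.mpr hn
      -- subtracting this multiple of `(X ^ n - 1) ^ k` makes the error term vanish at `1`
      set c : F := r.eval 1 / n ^ k with hc
      have hdvd : X - C (1 : F) ∣ r - C c * s ^ k := by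
        rw [dvd_iff_isRoot, IsRoot, eval_sub, eval_mul, eval_C, eval_pow, hs1, hc]
        field_simp
        simp
      obtain ⟨t, ht⟩ := hdvd
      refine ⟨p - C c * (X - 1) ^ k, t, ?_⟩
      simp only [sub_comp, mul_comp, pow_comp, C_comp, X_comp, one_comp, hX, mul_pow]
      rw [map_one] at ht
      rw [pow_succ]
      linear_combination hr + (X - 1) ^ k * ht
  obtain ⟨k, hk⟩ := ha
  obtain ⟨p, r, hr⟩ := key k
  refine ⟨p, ?_⟩
  have := congrArg (aeval a) hr
  rw [map_mul, map_pow, map_sub, map_sub, aeval_X, map_one, hk, zero_mul, aeval_comp, map_pow,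
    aeval_X] at this
  exact sub_eq_zero.mp this

lemma isNilpotent_mul_sub_one {E : Type*} [Ring E] {a b : E} (h : Commute a b)
    (ha : IsNilpotent (a - 1)) (hb : IsNilpotent (b - 1)) : IsNilpotent (a * b - 1) := by
  have h1 : a * b - 1 = a * (b - 1) + (a - 1) := by noncomm_ring
  have h2 : Commute a (b - 1) := h.sub_right (Commute.one_right a)
  have h3 : Commute a (a - 1) := (Commute.refl a).sub_right (Commute.one_right a)
  have h4 : Commute (b - 1) (a - 1) := (h2.sub_left (Commute.one_left _)).symm
  rw [h1]
  exact Commute.isNilpotent_add (h3.mul_left h4) (h2.isNilpotent_mul_left hb) ha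

/-- Let `H` be a finite-index subgroup of `G` whose image under `f` commutes with the image of `G`.
If `f s` is unipotent and `s ^ n ∈ H`, then `f s` is a polynomial in `f (s ^ n)`, so it
commutes with the image of `G`; hence the elements with unipotent image form a subgroup. -/
def unipotentSubgroup (F : Type*) {G E : Type*} [Group G] [Field F] [CharZero F] [Ring E]
    [Algebra F E] (f : G →* E) (H : Subgroup G) [H.FiniteIndex]
    (hH : ∀ h ∈ H, ∀ s, Commute (f h) (f s)) : Subgroup G where
  carrier := {s | IsNilpotent (f s - 1)}
  one_mem' := by simp
  inv_mem' := by
    intro s (hs : IsNilpotent (f s - 1))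
    show IsNilpotent (f s⁻¹ - 1)
    have hinv : f s⁻¹ * f s = 1 := by rw [← map_mul, inv_mul_cancel, map_one]
    have hinv' : f s * f s⁻¹ = 1 := by rw [← map_mul, mul_inv_cancel, map_one]
    have h1 : f s⁻¹ - 1 = f s⁻¹ * -(f s - 1) := by
      rw [neg_sub, mul_sub, hinv, mul_one]
    have h2 : Commute (f s⁻¹) (-(f s - 1)) := by
      rw [neg_sub]
      exact (Commute.one_right _).sub_right (hinv.trans hinv'.symm)
    rw [h1]
    exact h2.isNilpotent_mul_left hs.neg
  mul_mem' := by
    intro s t (hs : IsNilpotent (f s - 1)) (ht : IsNilpotent (f t - 1))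
    show IsNilpotent (f (s * t) - 1)
    obtain ⟨n, hn, -, hmem⟩ := Subgroup.exists_pow_mem_of_index_ne_zero
      (Subgroup.FiniteIndex.index_ne_zero (H := H)) s
    obtain ⟨p, hp⟩ := exists_aeval_pow_eq_of_isNilpotent_sub_one (F := F) hs hn.ne'
    rw [map_mul]
    refine isNilpotent_mul_sub_one ?_ hs ht
    rw [← hp, ← map_pow]
    clear hp
    induction p using Polynomial.induction_on' with
    | add p q hp hq => rw [map_add]; exact hp.add_left hq
    | monomial k c =>
      rw [aeval_monomial]
      exact Commute.mul_left (Algebra.commutes c _) ((hH _ hmem t).pow_left k)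

end Unipotent

/-! ### Unipotence and the trace -/

section Trace

open Polynomial

/-- Complex roots of unity lie on the unit circle, so their real parts are at most `1`. -/
lemma eq_one_of_sum_eq_card_complex (s : Multiset ℂ) {n : ℕ} (hn : n ≠ 0)
    (hs : ∀ z ∈ s, z ^ n = 1) (hsum : s.sum = s.card) : ∀ z ∈ s, z = 1 := by
  have hnorm : ∀ z ∈ s, ‖z‖ = 1 := fun z hz ↦ Complex.norm_eq_one_of_pow_eq_one (hs z hz) hn
  intro z hz
  have hre : ∀ z ∈ s, z.re ≤ 1 := fun z hz ↦ (Complex.re_le_norm z).trans (hnorm z hz).le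
  obtain ⟨t, rfl⟩ := Multiset.exists_cons_of_mem hz
  have ht : (t.map Complex.re).sum ≤ t.card := by
    have := Multiset.sum_le_card_nsmul (t.map Complex.re) 1 (by
      intro x hx
      obtain ⟨w, hw, rfl⟩ := Multiset.mem_map.mp hx
      exact hre w (Multiset.mem_cons_of_mem hw))
    simpa using this
  have hsum' := congrArg Complex.re hsum
  have hmap : (t.sum).re = (t.map Complex.re).sum := map_multiset_sum Complex.reAddGroupHom t
  simp only [Multiset.sum_cons, Multiset.card_cons, Complex.add_re, hmap, Complex.natCast_re,
    Nat.cast_add, Nat.cast_one, Complex.one_re] at hsum'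
  have h1 : z.re = 1 := le_antisymm (hre z hz) (by linarith)
  have h2 : z.im = 0 := by
    have := Complex.sq_norm_sub_sq_re z
    rw [hnorm z hz, h1] at this
    nlinarith
  exact Complex.ext (by simpa using h1) (by simpa using h2)

lemma eq_one_of_sum_eq_card {Ω : Type*} [Field Ω] [CharZero Ω] (s : Multiset Ω) {n : ℕ}
    (hn : n ≠ 0) (hs : ∀ z ∈ s, z ^ n = 1) (hsum : s.sum = s.card) : ∀ z ∈ s, z = 1 := by
  have hint : ∀ z ∈ s, z ∈ algebraicClosure ℚ Ω := fun z hz ↦ by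
    rw [mem_algebraicClosure_iff]
    exact ⟨X ^ n - 1, X_pow_sub_C_ne_zero (Nat.pos_of_ne_zero hn) 1, by simp [hs z hz]⟩
  have : Algebra.IsAlgebraic ℚ (algebraicClosure ℚ Ω) := algebraicClosure.isAlgebraic ℚ Ω
  let φ : algebraicClosure ℚ Ω →ₐ[ℚ] ℂ := IsAlgClosed.lift
  lift s to Multiset (algebraicClosure ℚ Ω) using hint
  have hval : Function.Injective (algebraMap (algebraicClosure ℚ Ω) Ω) :=
    (algebraMap (algebraicClosure ℚ Ω) Ω).injective
  have h1 := eq_one_of_sum_eq_card_complex (s.map φ) hn (by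
    intro z hz
    obtain ⟨w, hw, rfl⟩ := Multiset.mem_map.mp hz
    have := hs w (Multiset.mem_map_of_mem _ hw)
    rw [← map_pow, show w ^ n = 1 from hval (by simpa using this), map_one]) (by
    rw [Multiset.card_map, ← map_multiset_sum]
    rw [Multiset.card_map] at hsum
    have : s.sum = s.card := hval (by
      rw [map_multiset_sum, map_natCast]; exact hsum)
    rw [this, map_natCast])
  intro z hz
  obtain ⟨w, hw, rfl⟩ := Multiset.mem_map.mp hz
  have := h1 (φ w) (Multiset.mem_map_of_mem _ hw)
  rw [show w = 1 from φ.toRingHom.injective (this.trans (map_one φ).symm)]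
  rfl

/-- An endomorphism with a unipotent positive power has eigenvalues that are roots of unity, so it
is unipotent as soon as its trace is the dimension. -/
lemma isNilpotent_sub_one_of_trace_eq_finrank {F V : Type*} [Field F] [CharZero F] [AddCommGroup V]
    [Module F V] [FiniteDimensional F V] (f : Module.End F V) {n : ℕ} (hn : n ≠ 0)
    (hf : IsNilpotent (f ^ n - 1)) (htr : LinearMap.trace F V f = Module.finrank F V) :
    IsNilpotent (f - 1) := by
  let Ω := AlgebraicClosure F
  let A := LinearMap.toMatrix (Module.finBasis F V) (Module.finBasis F V) f
  let B := A.map (algebraMap F Ω)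
  have hsplit : B.charpoly.Splits := IsAlgClosed.splits _
  have hAn : IsNilpotent (A ^ n - 1) := by
    have := hf.map (LinearMap.toMatrixAlgEquiv (Module.finBasis F V))
    rwa [map_sub, map_pow, map_one] at this
  have hBn : IsNilpotent (B ^ n - 1) := by
    have := hAn.map (algebraMap F Ω).mapMatrix
    rwa [map_sub, map_pow, map_one] at this
  have hroots : ∀ z ∈ B.charpoly.roots, z = 1 := by
    refine eq_one_of_sum_eq_card _ hn ?_ ?_
    · intro z hz
      have h1 : Module.End.HasEigenvalue (Matrix.toLin' B) z := by
        rw [Module.End.hasEigenvalue_iff_isRoot_charpoly, Matrix.charpoly_toLin']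
        exact isRoot_of_mem_roots hz
      obtain ⟨v, hv⟩ := h1.exists_hasEigenvector
      obtain ⟨k, hk⟩ := hBn
      have h2 := Module.End.aeval_apply_of_hasEigenvector (p := (X ^ n - 1) ^ k) hv
      have h3 : aeval (Matrix.toLin' B) ((X ^ n - 1 : Polynomial Ω) ^ k) = 0 := by
        have : (Matrix.toLinAlgEquiv' : _ ≃ₐ[Ω] _) ((B ^ n - 1) ^ k) = 0 := by rw [hk, map_zero]
        rw [map_pow, map_sub, map_pow, map_one] at this
        rw [map_pow, map_sub, map_pow, map_one, aeval_X]
        exact this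
      rw [h3, LinearMap.zero_apply] at h2
      have h4 := (smul_eq_zero.mp h2.symm).resolve_right hv.2
      have h5 : z ^ n - 1 = 0 := eq_zero_of_pow_eq_zero (n := k) (by simpa using h4)
      exact sub_eq_zero.mp h5
    · rw [← Matrix.trace_eq_sum_roots_charpoly_of_splits hsplit, ← hsplit.natDegree_eq_card_roots,
        Matrix.charpoly_natDegree_eq_dim, Fintype.card_fin]
      have h1 : A.trace = Module.finrank F V := by
        rw [← htr, LinearMap.trace_eq_matrix_trace F (Module.finBasis F V)]
      show (A.map (algebraMap F Ω)).trace = _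
      rw [← AddMonoidHom.map_trace (algebraMap F Ω), h1]
      simp
  have hchar : f.charpoly = (X - 1) ^ Module.finrank F V := by
    apply Polynomial.map_injective _ (algebraMap F Ω).injective
    have h1 : f.charpoly = A.charpoly := (LinearMap.charpoly_toMatrix f _).symm
    have h2 : B.charpoly = f.charpoly.map (algebraMap F Ω) := by
      rw [h1]; exact Matrix.charpoly_map _ _
    rw [← h2, hsplit.eq_prod_roots_of_monic (Matrix.charpoly_monic _),
      Multiset.map_congr rfl (g := fun _ ↦ X - C 1) fun z hz ↦ by rw [hroots z hz],
      Multiset.map_const',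
      Multiset.prod_replicate, ← hsplit.natDegree_eq_card_roots,
      Matrix.charpoly_natDegree_eq_dim, Fintype.card_fin]
    simp
  refine ⟨Module.finrank F V, ?_⟩
  have := f.aeval_self_charpoly
  rw [hchar] at this
  simpa using this

lemma trace_eq_finrank_of_isNilpotent_sub_one {F V : Type*} [Field F] [AddCommGroup V]
    [Module F V] [FiniteDimensional F V] {f : Module.End F V} (hf : IsNilpotent (f - 1)) :
    LinearMap.trace F V f = Module.finrank F V := by
  have h := (LinearMap.isNilpotent_trace_of_isNilpotent hf).eq_zero
  rwa [map_sub, sub_eq_zero, LinearMap.trace_one] at h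

end Trace

/-! ### Finite extensions of complete discrete valuation rings -/

section CompleteLocal

open IsLocalRing

lemma isAdicComplete_of_finite {R M : Type*} [CommRing R] [IsNoetherianRing R] [IsLocalRing R]
    [IsAdicComplete (maximalIdeal R) R] [AddCommGroup M] [Module R M] [Module.Finite R M] :
    IsAdicComplete (maximalIdeal R) M := by
  have hs : Function.Surjective (AdicCompletion.of (maximalIdeal R) M) := by
    intro y
    obtain ⟨t, rfl⟩ := AdicCompletion.ofTensorProduct_surjective_of_finite (maximalIdeal R) M y
    induction t with
    | zero => exact ⟨0, by simp⟩
    | add a b ha hb =>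
      obtain ⟨x, hx⟩ := ha
      obtain ⟨z, hz⟩ := hb
      exact ⟨x + z, by rw [map_add, map_add, hx, hz]⟩
    | tmul r x =>
      obtain ⟨r, rfl⟩ := AdicCompletion.of_surjective (maximalIdeal R) R r
      refine ⟨r • x, ?_⟩
      rw [AdicCompletion.ofTensorProduct_tmul, map_smul]
      ext n
      rfl
  have := AdicCompletion.of_surjective_iff.mp hs
  exact { }

/-- A domain finite over a complete Noetherian local ring is local: two distinct maximal ideals
would be separated by an element idempotent modulo the maximal ideal of the base, and Hensel's
lemma lifts it to a nontrivial idempotent. -/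
lemma isLocalRing_of_finite_of_isAdicComplete {R S : Type*} [CommRing R] [IsNoetherianRing R]
    [IsLocalRing R] [IsAdicComplete (maximalIdeal R) R] [CommRing S] [IsDomain S] [Algebra R S]
    [Module.Finite R S] : IsLocalRing S := by
  set I := (maximalIdeal R).map (algebraMap R S) with hI
  have hcomp : IsAdicComplete I S :=
    (IsAdicComplete.map_algebraMap_iff _ _).mpr isAdicComplete_of_finite
  have hIle : ∀ P : Ideal S, P.IsMaximal → I ≤ P := fun P hP ↦
    (IsAdicComplete.le_jacobson_bot I).trans (by
      rw [Ideal.jacobson]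
      exact sInf_le ⟨bot_le, hP⟩)
  refine IsLocalRing.of_unique_max_ideal ?_
  obtain ⟨P, hP⟩ := Ideal.exists_maximal S
  refine ⟨P, hP, fun Q hQ ↦ ?_⟩
  by_contra hne
  obtain ⟨a, haP, haQ⟩ : ∃ a ∈ P, a ∉ Q := by
    by_contra! h
    exact hne (hP.eq_of_le hQ.ne_top h).symm
  -- the powers of `a` stabilise in the Artinian quotient `S ⧸ I`
  have hart : IsArtinianRing (S ⧸ I) := by
    let _ : Algebra (ResidueField R) (S ⧸ I) :=
      (Ideal.quotientMap I (algebraMap R S) Ideal.le_comap_map).toAlgebra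
    have : IsScalarTower R (ResidueField R) (S ⧸ I) := IsScalarTower.of_algebraMap_eq fun _ ↦ rfl
    have hfin : Module.Finite R (S ⧸ I) :=
      Module.Finite.of_surjective (Ideal.Quotient.mkₐ R I).toLinearMap
        Ideal.Quotient.mk_surjective
    have : Module.Finite (ResidueField R) (S ⧸ I) := Module.Finite.of_restrictScalars_finite R _ _
    exact IsArtinianRing.of_finite (ResidueField R) (S ⧸ I)
  obtain ⟨m, hm, b, hb⟩ : ∃ m, m ≠ 0 ∧ ∃ b, a ^ m - a ^ (2 * m) * b ∈ I := by
    obtain ⟨n, y, hy⟩ := IsArtinian.exists_pow_succ_smul_dvd (Ideal.Quotient.mk I a) (1 : S ⧸ I)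
    obtain ⟨y, rfl⟩ := Ideal.Quotient.mk_surjective y
    have h : ∀ j, Ideal.Quotient.mk I a ^ n =
        Ideal.Quotient.mk I a ^ (n + j) * Ideal.Quotient.mk I y ^ j := by
      intro j
      induction j with
      | zero => simp
      | succ j ih =>
        simp only [smul_eq_mul, mul_one] at hy
        rw [ih, pow_add, ← hy, Nat.succ_eq_add_one]
        ring
    refine ⟨n + 1, n.succ_ne_zero, y ^ (n + 1), ?_⟩
    rw [← Ideal.Quotient.eq, map_mul, map_pow, map_pow, map_pow, pow_succ, h (n + 1)]
    ring
  set e := a ^ m * b with he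
  have hidem : e * e - e ∈ I := by
    have : e * e - e = -(b * (a ^ m - a ^ (2 * m) * b)) := by rw [he]; ring
    rw [this]
    exact I.neg_mem (I.mul_mem_left _ hb)
  have heP : e ∈ P := P.mul_mem_right _ (Ideal.pow_mem_of_mem P haP m (Nat.pos_of_ne_zero hm))
  obtain ⟨r, hr, hre⟩ := HenselianRing.is_henselian (I := I) (Polynomial.X ^ 2 - Polynomial.X)
    (Polynomial.monic_X_pow_sub (by simp)) e (by simpa [pow_two] using hidem) (by
      refine IsUnit.of_mul_eq_one (Ideal.Quotient.mk I (2 * e - 1)) ?_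
      rw [← map_mul, ← map_one (Ideal.Quotient.mk I), Ideal.Quotient.eq]
      simp only [Polynomial.derivative_sub, Polynomial.derivative_X_pow, Polynomial.derivative_X,
        Polynomial.eval_sub, Polynomial.eval_mul, Polynomial.eval_C, Polynomial.eval_pow,
        Polynomial.eval_X, Polynomial.eval_one]
      convert! I.mul_mem_left 4 hidem using 1
      push_cast
      ring)
  have hr' : r * (r - 1) = 0 := by
    have : r ^ 2 - r = 0 := by simpa using hr
    linear_combination this
  have hrP : r ∈ P := by
    have := P.add_mem (hIle P hP hre) heP
    simpa using this
  rcases mul_eq_zero.mp hr' with rfl | h1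
  · have heQ : e ∈ Q := by
      have := hIle Q hQ hre
      rw [zero_sub] at this
      exact Q.neg_mem_iff.mp this
    have h2 : a ^ m ∈ Q := by
      have h3 := Q.add_mem (hIle Q hQ hb) (Q.mul_mem_left (a ^ m) heQ)
      convert! h3 using 1
      rw [he]
      ring
    exact haQ (hQ.isPrime.mem_of_pow_mem m h2)
  · rw [sub_eq_zero.mp h1] at hrP
    exact hP.ne_top ((Ideal.eq_top_iff_one P).mpr hrP)

end CompleteLocal

/-! ### Tame automorphisms of discrete valuation rings -/

section Tame

open IsLocalRing

/-- Let `σ` be an endomorphism of a Noetherian local ring with principal maximal ideal `𝔪 = (π)`,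
of finite order prime to the residue characteristic, acting trivially modulo `𝔪` and
fixing `π` modulo `𝔪 ^ 2`. Averaging over the powers of `σ` gives a fixed generator of `𝔪` and fixed
representatives modulo `𝔪`, so `σ` is the identity modulo every power of `𝔪`. -/
lemma eq_self_of_sub_mem_maximalIdeal {S : Type*} [CommRing S] [IsLocalRing S] [IsNoetherianRing S]
    {π : S} (hπ : maximalIdeal S = Ideal.span {π}) (σ : S →+* S) {n : ℕ}
    (hn : IsUnit (n : S)) (hσn : ∀ x, σ^[n] x = x) (hσ : ∀ x, σ x - x ∈ maximalIdeal S)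
    (hσπ : σ π - π ∈ maximalIdeal S ^ 2) (x : S) : σ x = x := by
  obtain ⟨u, hu⟩ := hn
  have hσu : σ (u⁻¹ : Sˣ) = (u⁻¹ : Sˣ) := by
    have h1 : σ (u : S) = u := by rw [hu, map_natCast]
    have h2 : σ (u⁻¹ : Sˣ) * u = 1 := by rw [← h1, ← map_mul, Units.inv_mul, map_one]
    exact (Units.mul_eq_one_iff_eq_inv).mp h2
  let avg : S → S := fun x ↦ (u⁻¹ : Sˣ) * ∑ i ∈ Finset.range n, σ^[i] x
  have hfix : ∀ x, σ (avg x) = avg x := by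
    intro x
    simp only [avg, map_mul, hσu, map_sum, ← Function.iterate_succ_apply']
    congr 1
    have h1 := Finset.sum_range_succ (fun i ↦ σ^[i] x) n
    rw [Finset.sum_range_succ'] at h1
    rw [hσn] at h1
    simpa using h1
  have hmem : ∀ (J : Ideal S), (∀ y ∈ J, σ y ∈ J) → ∀ x, σ x - x ∈ J → avg x - x ∈ J := by
    intro J hJ x hx
    have h1 : ∀ i, σ^[i] x - x ∈ J := by
      intro i
      induction i with
      | zero => simp
      | succ i ih =>
        rw [Function.iterate_succ_apply']
        have := J.add_mem (hJ _ ih) hx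
        rw [map_sub] at this
        simpa using this
    have h2 : avg x - x = (u⁻¹ : Sˣ) * ∑ i ∈ Finset.range n, (σ^[i] x - x) := by
      rw [Finset.sum_sub_distrib, mul_sub]
      simp only [Finset.sum_const, Finset.card_range, nsmul_eq_mul, ← hu]
      rw [Units.inv_mul_cancel_left]
    rw [h2]
    exact J.mul_mem_left _ (J.sum_mem fun i _ ↦ h1 i)
  have hstab : ∀ y ∈ maximalIdeal S, σ y ∈ maximalIdeal S := by
    intro y hy
    have := (maximalIdeal S).add_mem (hσ y) hy
    simpa using this
  have hstab2 : ∀ y ∈ maximalIdeal S ^ 2, σ y ∈ maximalIdeal S ^ 2 := by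
    have h1 : maximalIdeal S ≤ (maximalIdeal S).comap σ := hstab
    intro y hy
    have h2 : maximalIdeal S ^ 2 ≤ (maximalIdeal S ^ 2).comap σ :=
      (Ideal.pow_right_mono h1 2).trans (Ideal.le_comap_pow σ 2)
    exact h2 hy
  -- the average of `π` is a fixed uniformizer
  obtain ⟨v, hv, hvπ⟩ : ∃ v : S, IsUnit v ∧ avg π = π * v := by
    have h1 := hmem _ hstab2 π hσπ
    rw [hπ, Ideal.span_singleton_pow, Ideal.mem_span_singleton] at h1
    obtain ⟨z, hz⟩ := h1
    refine ⟨1 + π * z, ?_, by linear_combination hz⟩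
    have h2 : π * z ∈ maximalIdeal S := by
      rw [hπ]; exact Ideal.mul_mem_right _ _ (Ideal.mem_span_singleton_self π)
    by_contra h3
    have h4 : (1 + π * z) ∈ maximalIdeal S := h3
    exact (Ideal.ne_top_iff_one _).mp (maximalIdeal.isMaximal S).ne_top
      (by simpa using (maximalIdeal S).sub_mem h4 h2)
  have key : ∀ k : ℕ, ∀ x, σ x - x ∈ maximalIdeal S ^ k := by
    intro k
    induction k with
    | zero => simp
    | succ k ih =>
      intro x
      have h1 := hmem _ hstab x (hσ x)
      rw [hπ, Ideal.mem_span_singleton] at h1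
      obtain ⟨y, hy⟩ := h1
      obtain ⟨w, rfl⟩ := hv
      set y' := (w⁻¹ : Sˣ) * y with hy'
      have h2 : x = avg x - avg π * y' := by
        rw [hvπ, hy', mul_assoc, Units.mul_inv_cancel_left, ← hy]; ring
      have h3 : σ x - x = avg π * -(σ y' - y') := by
        conv_lhs => rw [h2]
        rw [map_sub, hfix x, show σ (avg π * y') = avg π * σ y' by
          rw [RingHom.map_mul, hfix π]]
        ring
      rw [h3, pow_succ']
      refine Ideal.mul_mem_mul ?_ (Ideal.neg_mem_iff _ |>.mpr (ih y'))
      rw [hvπ, hπ]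
      exact Ideal.mul_mem_right _ _ (Ideal.mem_span_singleton_self π)
  have h0 : σ x - x ∈ (⨅ k : ℕ, maximalIdeal S ^ k) := by
    rw [Ideal.mem_iInf]
    exact fun k ↦ key k x
  rw [Ideal.iInf_pow_eq_bot_of_isLocalRing _ (maximalIdeal.isMaximal S).ne_top] at h0
  exact sub_eq_zero.mp h0

end Tame

/-! ### The Galois action on the integral closure in a separable closure -/

section Galois

open IsLocalRing

variable {R : Type*} [CommRing R] {K : Type*} [Field K] [Algebra R K]
    {E : Type*} [Field E] [Algebra K E] [Algebra R E] [IsScalarTower R K E]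

/-- The inclusion of the integral closure of `R` in a subextension `L` of `E` into the integral
closure of `R` in `E`. -/
noncomputable def integralInclusion (R : Type*) [CommRing R] {K : Type*} [Field K] [Algebra R K]
    {E : Type*} [Field E] [Algebra K E] [Algebra R E] [IsScalarTower R K E]
    (L : IntermediateField K E) : integralClosure R L →ₐ[R] integralClosure R E :=
  (L.val.restrictScalars R).mapIntegralClosure

lemma integralInclusion_injective (L : IntermediateField K E) :
    Function.Injective (integralInclusion R L) := by
  intro x y h
  exact Subtype.ext (Subtype.ext (congrArg (fun z : integralClosure R E ↦ (z : E)) h))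

lemma smul_integralInclusion (L : IntermediateField K E) [Normal K L] (σ : Gal(E/K))
    (x : integralClosure R L) :
    σ • integralInclusion R L x = integralInclusion R L (σ.restrictNormal L • x) := by
  apply Subtype.ext
  exact (AlgEquiv.restrictNormal_commutes σ L (x : L)).symm

lemma mem_inertiaGroup_iff {M : Ideal (integralClosure R E)} {σ : Gal(E/K)} :
    σ ∈ inertiaGroup R K E M ↔ ∀ x : integralClosure R E, σ • x - x ∈ M := Iff.rfl

lemma mem_maximalIdeal_iff_integralInclusion_mem
    (L : IntermediateField K E) [IsLocalRing (integralClosure R L)]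
    (M : Ideal (integralClosure R E)) [M.IsMaximal] (x : integralClosure R L) :
    x ∈ maximalIdeal (integralClosure R L) ↔ integralInclusion R L x ∈ M := by
  have hint : (integralInclusion R L).toRingHom.IsIntegral := by
    have h : ((integralInclusion R L).toRingHom.comp
        (algebraMap R (integralClosure R L))).IsIntegral := by
      have : (integralInclusion R L).toRingHom.comp (algebraMap R (integralClosure R L)) =
        algebraMap R (integralClosure R E) := (integralInclusion R L).comp_algebraMap
      rw [this]
      exact Algebra.IsIntegral.isIntegral
    exact h.tower_top _ _
  have := Ideal.isMaximal_comap_of_isIntegral_of_isMaximal' _ hint M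
  rw [← IsLocalRing.eq_maximalIdeal this]
  rfl

variable [IsFractionRing R K]

lemma faithfulSMul_integralClosure (L : IntermediateField K E) :
    FaithfulSMul R (integralClosure R L) := by
  rw [faithfulSMul_iff_algebraMap_injective]
  refine Function.Injective.of_comp (f := algebraMap (integralClosure R L) L) ?_
  rw [← RingHom.coe_comp, ← IsScalarTower.algebraMap_eq, IsScalarTower.algebraMap_eq R K L]
  exact (algebraMap K L).injective.comp (IsFractionRing.injective R K)

variable [IsDomain R] [IsDiscreteValuationRing R]

lemma finite_integralClosure [Algebra.IsSeparable K E] (L : IntermediateField K E)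
    [FiniteDimensional K L] : Module.Finite R (integralClosure R L) :=
  IsIntegralClosure.finite R K L (integralClosure R L)

variable [IsAdicComplete (maximalIdeal R) R]

lemma isLocalRing_integralClosure [Algebra.IsSeparable K E] (L : IntermediateField K E)
    [FiniteDimensional K L] : IsLocalRing (integralClosure R L) :=
  have : Module.Finite R (integralClosure R L) := finite_integralClosure L
  isLocalRing_of_finite_of_isAdicComplete (R := R)

/-- As `R` is complete, the maximal ideal of the integral closure is unique, so it is stable under
the Galois group. -/
lemma smul_mem_of_isMaximal [IsGalois K E] (M : Ideal (integralClosure R E)) [M.IsMaximal]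
    (σ : Gal(E/K)) {x : integralClosure R E} (hx : x ∈ M) : σ • x ∈ M := by
  have : FiniteDimensional K (IntermediateField.adjoin K {(x : E)}) :=
    IntermediateField.adjoin.finiteDimensional (Algebra.IsIntegral.isIntegral (x : E))
  let L := IntermediateField.normalClosure K (IntermediateField.adjoin K {(x : E)}) E
  have : FiniteDimensional K L := normalClosure.is_finiteDimensional ..
  have : Normal K L := normalClosure.normal ..
  have := isLocalRing_integralClosure (R := R) L
  have hxL : (x : E) ∈ L := (IntermediateField.le_normalClosure _)
    (IntermediateField.mem_adjoin_simple_self K (x : E))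
  have hxint : IsIntegral R (⟨x, hxL⟩ : L) :=
    (isIntegral_algHom_iff (L.val.restrictScalars R) L.val.injective).mp x.2
  let y : integralClosure R L := ⟨⟨x, hxL⟩, hxint⟩
  have hxy : x = integralInclusion R L y := rfl
  rw [hxy, ← mem_maximalIdeal_iff_integralInclusion_mem] at hx
  rw [hxy, smul_integralInclusion, ← mem_maximalIdeal_iff_integralInclusion_mem]
  intro hu
  apply hx
  have := hu.map (MulSemiringAction.toRingHom Gal(L/K) (integralClosure R L)
    (σ.restrictNormal L)⁻¹)
  simpa using this

lemma inertiaGroup_normal [IsGalois K E] (M : Ideal (integralClosure R E)) [M.IsMaximal] :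
    (inertiaGroup R K E M).Normal := by
  refine ⟨fun h hh g ↦ mem_inertiaGroup_iff.mpr fun x ↦ ?_⟩
  have := smul_mem_of_isMaximal M g (mem_inertiaGroup_iff.mp hh (g⁻¹ • x))
  rw [smul_sub, smul_inv_smul, smul_smul, smul_smul] at this
  exact this

/-- For a finite Galois subextension `L`, a uniformizer `ϖ` of `L` is an eigenvector for the Galois
group up to integral factors, and an inertia element of finite order prime to the residue
characteristic on `L` that fixes `ϖ` up to a factor congruent to `1` fixes `L`. -/
lemma exists_uniformizer [IsGalois K E] (M : Ideal (integralClosure R E)) [M.IsMaximal]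
    (L : IntermediateField K E) [FiniteDimensional K L] [Normal K L] :
    ∃ ϖ : integralClosure R E, ϖ ≠ 0 ∧ (∀ σ : Gal(E/K), ∃ w, σ • ϖ = ϖ * w) ∧
      (∀ σ ∈ L.fixingSubgroup, σ • ϖ = ϖ) ∧
      ∀ k ∈ inertiaGroup R K E M, ∀ N : ℕ, IsUnit (N : R) → k ^ N ∈ L.fixingSubgroup →
        (∀ w, k • ϖ = ϖ * w → w - 1 ∈ M) → k ∈ L.fixingSubgroup := by
  have := isLocalRing_integralClosure (R := R) L
  have : IsDedekindDomain (integralClosure R L) := integralClosure.isDedekindDomain R K L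
  obtain ⟨π, hπ⟩ := (IsPrincipalIdealRing.principal (maximalIdeal (integralClosure R L))).principal
  rw [Ideal.submodule_span_eq] at hπ
  have hstab : ∀ (τ : Gal(L/K)) (x : integralClosure R L), x ∈ maximalIdeal (integralClosure R L) →
      τ • x ∈ maximalIdeal (integralClosure R L) := by
    intro τ x hx hu
    apply hx
    have := hu.map (MulSemiringAction.toRingHom Gal(L/K) (integralClosure R L) τ⁻¹)
    simpa using this
  have hπmem : π ∈ maximalIdeal (integralClosure R L) := by
    rw [hπ]; exact Ideal.mem_span_singleton_self π
  have hdvd : ∀ τ : Gal(L/K), ∃ w, τ • π = π * w := by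
    intro τ
    have := hstab τ π hπmem
    rw [hπ, Ideal.mem_span_singleton] at this
    exact this
  refine ⟨integralInclusion R L π, ?_, ?_, ?_, ?_⟩
  -- if `π = 0`, the integral closure of `R` in `L` is a field, and so is `R`
  · intro h0
    have hπ0 : π = 0 := integralInclusion_injective L (h0.trans (map_zero _).symm)
    obtain ⟨p, hp⟩ := IsDiscreteValuationRing.exists_irreducible R
    have : FaithfulSMul R (integralClosure R L) := faithfulSMul_integralClosure L
    have hinj := FaithfulSMul.algebraMap_injective R (integralClosure R L)
    have hmem : algebraMap R (integralClosure R L) p ∈ maximalIdeal (integralClosure R L) := by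
      intro hu
      exact hp.not_isUnit (isUnit_of_map_unit _ _ hu)
    rw [hπ, hπ0, Ideal.mem_span_singleton, zero_dvd_iff] at hmem
    exact hp.ne_zero (hinj (hmem.trans (map_zero _).symm))
  · intro σ
    obtain ⟨w, hw⟩ := hdvd (σ.restrictNormal L)
    exact ⟨integralInclusion R L w, by rw [smul_integralInclusion, hw, map_mul]⟩
  · intro σ hσ
    exact Subtype.ext ((IntermediateField.mem_fixingSubgroup_iff _ _).mp hσ _ (π : L).2)
  · intro k hk N hN hkN hw
    set τ := k.restrictNormal L with hτ
    have hres : ∀ x : integralClosure R L, τ • x - x ∈ maximalIdeal (integralClosure R L) := by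
      intro x
      rw [mem_maximalIdeal_iff_integralInclusion_mem L M, map_sub, ← smul_integralInclusion]
      exact mem_inertiaGroup_iff.mp hk _
    have htriv : ∀ x : integralClosure R L, τ • x = x := by
      refine eq_self_of_sub_mem_maximalIdeal hπ
        (MulSemiringAction.toRingHom Gal(L/K) (integralClosure R L) τ) (n := N) ?_ ?_ hres ?_
      · simpa using hN.map (algebraMap R (integralClosure R L))
      · intro x
        have h1 : ∀ m : ℕ, ((MulSemiringAction.toRingHom Gal(L/K) (integralClosure R L) τ))^[m] x =
            τ ^ m • x := by
          intro m
          induction m with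
          | zero => simp
          | succ m ih =>
            rw [Function.iterate_succ_apply', ih, pow_succ', mul_smul]
            rfl
        rw [h1]
        apply integralInclusion_injective
        have h2 : τ ^ N = (k ^ N).restrictNormal L :=
          (map_pow (AlgEquiv.restrictNormalHom (F := K) (K₁ := E) L) k N).symm
        rw [h2, ← smul_integralInclusion]
        exact Subtype.ext ((IntermediateField.mem_fixingSubgroup_iff _ _).mp hkN _ (x : L).2)
      · obtain ⟨w, hw'⟩ := hdvd τ
        have h1 : w - 1 ∈ maximalIdeal (integralClosure R L) := by
          rw [mem_maximalIdeal_iff_integralInclusion_mem L M, map_sub, map_one]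
          apply hw
          rw [smul_integralInclusion, hw', map_mul]
        have h2 : τ • π - π = π * (w - 1) := by rw [hw']; ring
        show τ • π - π ∈ _
        rw [h2, pow_two]
        exact Ideal.mul_mem_mul hπmem h1
    rw [IntermediateField.mem_fixingSubgroup_iff]
    intro x hx
    have : IsFractionRing (integralClosure R L) L :=
      IsIntegralClosure.isFractionRing_of_finite_extension R K L _
    obtain ⟨a, b, hb, hab⟩ := IsFractionRing.div_surjective (A := integralClosure R L) (⟨x, hx⟩ : L)
    have h1 : τ ⟨x, hx⟩ = ⟨x, hx⟩ := by
      rw [← hab, map_div₀]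
      congr 1
      · exact congrArg Subtype.val (htriv a)
      · exact congrArg Subtype.val (htriv b)
    have h2 := AlgEquiv.restrictNormal_commutes k L (⟨x, hx⟩ : L)
    rw [← hτ, h1] at h2
    exact h2.symm

end Galois

/-! ### Roots of unity and the tame inertia relation -/

section RootsOfUnity

open IsLocalRing

lemma eq_one_of_pow_eq_one_of_sub_one_mem {A : Type*} [CommRing A] [IsDomain A] {M : Ideal A}
    {N : ℕ} (hN : (N : A) ∉ M) {ζ : A} (hζ : ζ ^ N = 1) (h : ζ - 1 ∈ M) : ζ = 1 := by
  by_contra hne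
  apply hN
  have h1 : ∑ i ∈ Finset.range N, ζ ^ i = 0 := by
    have := mul_geom_sum ζ N
    rw [hζ, sub_self] at this
    exact (mul_eq_zero.mp this).resolve_left (sub_ne_zero.mpr hne)
  have h2 : (N : A) = -∑ i ∈ Finset.range N, (ζ ^ i - 1) := by
    rw [Finset.sum_sub_distrib, h1]
    simp
  rw [h2]
  refine M.neg_mem (M.sum_mem fun i _ ↦ ?_)
  obtain ⟨c, hc⟩ := sub_dvd_pow_sub_pow ζ 1 i
  rw [one_pow] at hc
  rw [hc]
  exact M.mul_mem_right _ h

lemma IsPrimitiveRoot.quotient_mk {A : Type*} [CommRing A] [IsDomain A] {M : Ideal A}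
    {N : ℕ} (hN : (N : A) ∉ M) {ζ : A} (hζ : IsPrimitiveRoot ζ N) :
    IsPrimitiveRoot (Ideal.Quotient.mk M ζ) N := by
  refine ⟨by rw [← map_pow, hζ.pow_eq_one, map_one], fun l hl ↦ hζ.dvd_of_pow_eq_one l ?_⟩
  refine eq_one_of_pow_eq_one_of_sub_one_mem hN ?_ ?_
  · rw [← pow_mul, mul_comm, pow_mul, hζ.pow_eq_one, one_pow]
  · rwa [← map_pow, ← map_one (Ideal.Quotient.mk M), Ideal.Quotient.eq] at hl

/-- `ConditionC` quantifies over finite extensions in the universe of `k`; passing to the image in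
an algebraic closure of `k` extends it to all universes. -/
lemma ConditionC.not_forall_isPrimitiveRoot {ℓ : ℕ} {k : Type*} [Field k] (hC : ConditionC ℓ k)
    (k' : Type*) [Field k'] [Algebra k k'] [FiniteDimensional k k'] :
    ¬ ∀ n : ℕ, ∃ ζ : k', IsPrimitiveRoot ζ (ℓ ^ n) := by
  intro h
  let f : k' →ₐ[k] AlgebraicClosure k := IsAlgClosed.lift
  have : FiniteDimensional k f.fieldRange :=
    LinearEquiv.finiteDimensional (AlgEquiv.ofInjectiveField f).toLinearEquiv
  refine hC f.fieldRange fun n ↦ ?_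
  obtain ⟨ζ, hζ⟩ := h n
  exact ⟨f.rangeRestrict ζ, hζ.map_of_injective (f := f.rangeRestrict) f.rangeRestrict.injective⟩

variable {R : Type*} [CommRing R]

lemma isUnit_natCast_of_ne_ringChar [IsLocalRing R] {ℓ : ℕ} [Fact ℓ.Prime]
    (hℓ : ℓ ≠ ringChar (ResidueField R)) : IsUnit (ℓ : R) := by
  by_contra h
  have h1 : (ℓ : ResidueField R) = 0 := by
    rw [← map_natCast (residue R), residue_eq_zero_iff]
    exact h
  have h2 : ringChar (ResidueField R) ∣ ℓ := ringChar.dvd h1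
  rcases (Nat.dvd_prime Fact.out).mp h2 with h3 | h3
  · exact CharP.ringChar_ne_one h3
  · exact hℓ h3.symm

lemma natCast_notMem {N : ℕ} (hN : IsUnit (N : R)) {A : Type*} [CommRing A] [Algebra R A]
    {M : Ideal A} (hM : M ≠ ⊤) : (N : A) ∉ M := by
  intro h
  apply hM
  refine Ideal.eq_top_of_isUnit_mem _ h ?_
  simpa using hN.map (algebraMap R A)

lemma hasEnoughRootsOfUnity_of_isUnit {E : Type*} [Field E] [Algebra R E] [IsSepClosed E]
    {N : ℕ} (hN : IsUnit (N : R)) :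
    HasEnoughRootsOfUnity E N := by
  have : NeZero (N : E) := ⟨by simpa using (hN.map (algebraMap R E)).ne_zero⟩
  infer_instance

variable {K : Type*} [Field K] [Algebra R K]
    {E : Type*} [Field E] [Algebra K E] [Algebra R E] [IsScalarTower R K E]

/-- Inertia fixes the roots of unity of order prime to the residue characteristic, as these are
separated modulo `M`. -/
lemma apply_eq_self_of_mem_inertiaGroup {M : Ideal (integralClosure R E)} (hM : M ≠ ⊤)
    {σ : Gal(E/K)} (hσ : σ ∈ inertiaGroup R K E M) {N : ℕ} (hN : IsUnit (N : R)) {ζ : E}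
    (hζ : ζ ^ N = 1) : σ ζ = ζ := by
  have := (algebraMap R E).domain_nontrivial
  have hN0 : N ≠ 0 := by rintro rfl; simp at hN
  have hζ0 : ζ ≠ 0 := by rintro rfl; simp [hN0] at hζ
  have hint : ∀ x : E, x ^ N = 1 → IsIntegral R x := fun x hx ↦
    IsIntegral.of_pow (Nat.pos_of_ne_zero hN0) (hx ▸ isIntegral_one)
  let z : integralClosure R E := ⟨ζ, hint ζ hζ⟩
  let z' : integralClosure R E := ⟨ζ⁻¹, hint _ (by rw [inv_pow, hζ, inv_one])⟩
  have hz : z' * z = 1 := Subtype.ext (inv_mul_cancel₀ hζ0)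
  have hzN : z ^ N = 1 := Subtype.ext hζ
  have hz'N : z' ^ N = 1 := Subtype.ext (by show ζ⁻¹ ^ N = 1; rw [inv_pow, hζ, inv_one])
  have h1 : z' * σ • z - 1 = z' * (σ • z - z) := by rw [mul_sub, hz]
  have h2 : z' * σ • z = 1 := by
    refine eq_one_of_pow_eq_one_of_sub_one_mem (natCast_notMem hN hM) ?_ ?_
    · rw [mul_pow, hz'N, ← smul_pow', hzN, smul_one, one_mul]
    · rw [h1]
      exact M.mul_mem_left _ (mem_inertiaGroup_iff.mp hσ z)
  have h3 : σ • z = z := by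
    have := congrArg (z * ·) h2
    simp only [← mul_assoc, mul_comm z z', hz, one_mul, mul_one] at this
    exact this
  exact congrArg (fun x : integralClosure R E ↦ (x : E)) h3

variable [IsDomain R] [IsDiscreteValuationRing R] [IsFractionRing R K]
    [IsAdicComplete (maximalIdeal R) R]

/-- The tame relation `g h g⁻¹ = h ^ a` in a finite quotient of the Galois group, for `h` in the
inertia group whose image has order dividing `N`, where `N` is prime to the residue characteristic
and `g` raises `N`-th roots of unity to the power `a`. The tame character `θ σ = σ ϖ / ϖ` modulo
`M` is multiplicative on inertia, takes `h` to an `N`-th root of unity, and satisfies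
`θ (g h g⁻¹) = g (θ h) = θ h ^ a`; it is injective on inertia elements of order prime to the
residue characteristic. -/
theorem mul_mem_of_tame [IsSepClosure K E] (M : Ideal (integralClosure R E)) [M.IsMaximal]
    (U : Subgroup Gal(E/K)) [U.Normal] (hU : IsOpen (U : Set Gal(E/K)))
    {g h : Gal(E/K)} (hh : h ∈ inertiaGroup R K E M) {N : ℕ} (hN : IsUnit (N : R)) {a : ℕ}
    (hga : ∀ ζ : E, ζ ^ N = 1 → g ζ = ζ ^ a) (hhN : h ^ N ∈ U)
    (hkN : (g * h * g⁻¹ * (h ^ a)⁻¹) ^ N ∈ U) : g * h * g⁻¹ * (h ^ a)⁻¹ ∈ U := by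
  have hsep : IsSepClosed E := IsSepClosure.sep_closed K
  have hgal : IsGalois K E := inferInstance
  have hInormal := inertiaGroup_normal (R := R) (K := K) M
  have hN0 : N ≠ 0 := by rintro rfl; simp at hN
  set L := IntermediateField.fixedField U with hL
  have hfix : L.fixingSubgroup = U := InfiniteGalois.fixingSubgroup_fixedField
    ⟨U, U.isClosed_of_isOpen hU⟩
  obtain ⟨hLfin, hLgal⟩ := (InfiniteGalois.isOpen_and_normal_iff_finite_and_isGalois L).mp
    (by rw [hfix]; exact ⟨hU, inferInstance⟩)
  obtain ⟨ϖ, hϖ0, hw, hϖU, hϖk⟩ := exists_uniformizer M L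
  rw [hfix] at hϖU hϖk
  choose w hw using hw
  let q := Ideal.Quotient.mk M
  have hcoc : ∀ s t, w (s * t) = w s * s • w t := by
    intro s t
    apply mul_left_cancel₀ hϖ0
    rw [← hw, mul_smul, hw t, smul_mul', hw s, mul_assoc]
  have hwU : ∀ s ∈ U, w s = 1 := by
    intro s hs
    apply mul_left_cancel₀ hϖ0
    rw [← hw, hϖU s hs, mul_one]
  have hI : ∀ s ∈ inertiaGroup R K E M, ∀ x, q (s • x) = q x := fun s hs x ↦
    Ideal.Quotient.eq.mpr (mem_inertiaGroup_iff.mp hs x)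
  have hθmul : ∀ s ∈ inertiaGroup R K E M, ∀ t, q (w (s * t)) = q (w s) * q (w t) := by
    intro s hs t
    rw [hcoc, map_mul, hI s hs]
  have hθpow : ∀ m, q (w (h ^ m)) = q (w h) ^ m := by
    intro m
    induction m with
    | zero => rw [pow_zero, pow_zero, hwU 1 U.one_mem, map_one]
    | succ m ih => rw [pow_succ', hθmul h hh, ih, pow_succ']
  have hwunit : ∀ s, q (w s) * q (s • w s⁻¹) = 1 := by
    intro s
    rw [← map_mul, ← hcoc, mul_inv_cancel, hwU 1 U.one_mem, map_one]
  -- `θ h` lifts to a root of unity of the separable closure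
  obtain ⟨z, hzN, hz⟩ : ∃ z : integralClosure R E, (z : E) ^ N = 1 ∧ q z = q (w h) := by
    have := hasEnoughRootsOfUnity_of_isUnit (E := E) hN
    obtain ⟨ζ, hζ⟩ := HasEnoughRootsOfUnity.exists_primitiveRoot E N
    let z : integralClosure R E := ⟨ζ, IsIntegral.of_pow (Nat.pos_of_ne_zero hN0)
      (hζ.pow_eq_one ▸ isIntegral_one)⟩
    have hzprim : IsPrimitiveRoot z N :=
      IsPrimitiveRoot.of_map_of_injective (f := (integralClosure R E).val) hζ
        Subtype.val_injective
    have hqz := hzprim.quotient_mk (natCast_notMem hN (M := M) (Ideal.IsMaximal.ne_top ‹_›))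
    have : NeZero N := ⟨hN0⟩
    obtain ⟨i, -, hi⟩ := hqz.eq_pow_of_pow_eq_one (ξ := q (w h))
      (by rw [← hθpow, hwU _ hhN, map_one])
    refine ⟨z ^ i, ?_, by rw [← hi]; exact map_pow q z i⟩
    show (ζ ^ i) ^ N = 1
    rw [← pow_mul, mul_comm, pow_mul, hζ.pow_eq_one, one_pow]
  have hgz : g • z = z ^ a := Subtype.ext (hga z hzN)
  have hconj : g * h * g⁻¹ ∈ inertiaGroup R K E M := hInormal.conj_mem h hh g
  have hθconj : q (w (g * h * g⁻¹)) = q (w h) ^ a := by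
    have h1 : q (w (g * h * g⁻¹)) * q (w g) = q (w g) * q (g • w h) := by
      rw [← hθmul _ hconj, inv_mul_cancel_right, hcoc, map_mul]
    have h2 : q (g • w h) = q (w h) ^ a := by
      rw [← hz, ← map_pow, ← hgz]
      refine Ideal.Quotient.eq.mpr ?_
      rw [← smul_sub]
      exact smul_mem_of_isMaximal M g (Ideal.Quotient.eq.mp hz.symm)
    calc q (w (g * h * g⁻¹)) = q (w (g * h * g⁻¹)) * q (w g) * q (g • w g⁻¹) := by
          rw [mul_assoc (q _), hwunit, mul_one]
      _ = q (w g) * q (g • w g⁻¹) * q (w h) ^ a := by rw [h1, h2, mul_right_comm]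
      _ = q (w h) ^ a := by rw [hwunit, one_mul]
  have hk : g * h * g⁻¹ * (h ^ a)⁻¹ ∈ inertiaGroup R K E M :=
    mul_mem hconj (inv_mem (pow_mem hh a))
  refine hϖk _ hk N hN hkN fun w' hw' ↦ ?_
  have hww' : w' = w (g * h * g⁻¹ * (h ^ a)⁻¹) := mul_left_cancel₀ hϖ0 (hw'.symm.trans (hw _))
  rw [hww', ← Ideal.Quotient.eq, map_one]
  have h1 := hθmul _ hk (h ^ a)
  rw [inv_mul_cancel_right, hθconj, hθpow] at h1
  have h2 : q (w h) ^ a * q (h ^ a • w (h ^ a)⁻¹) = 1 := by rw [← hθpow]; exact hwunit _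
  exact ((IsUnit.of_mul_eq_one _ h2).mul_eq_right.mp h1.symm)

/-- Under `ConditionC` the powers of the `ℓ`-adic cyclotomic character are nontrivial: otherwise
its kernel is open, and a finite extension of `K`, hence its residue field, contains all roots of
unity of `ℓ`-power order. -/
theorem exists_cyclotomicCharacter_pow_ne_one [IsSepClosure K E] {ℓ : ℕ} [Fact ℓ.Prime]
    (hℓ : IsUnit (ℓ : R)) (hC : ConditionC ℓ (ResidueField R)) {i : ℕ} (hi : 1 ≤ i) :
    ∃ g : Gal(E/K), cyclotomicCharacter E ℓ g.toRingEquiv ^ i ≠ 1 := by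
  by_contra! hall
  have hsep : IsSepClosed E := IsSepClosure.sep_closed K
  have hgal : IsGalois K E := inferInstance
  have henough : ∀ n, HasEnoughRootsOfUnity E (ℓ ^ n) := fun n ↦
    hasEnoughRootsOfUnity_of_isUnit (R := R) (by rw [Nat.cast_pow]; exact hℓ.pow n)
  let χ : Gal(E/K) →* ℤ_[ℓ]ˣ :=
    (cyclotomicCharacter E ℓ).comp (MulSemiringAction.toRingAut Gal(E/K) E)
  have hχ : Continuous χ := cyclotomicCharacter.continuous ℓ K E
  have hfin : Finite χ.range := by
    have : NeZero i := ⟨by omega⟩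
    have hsub : (χ.range : Set ℤ_[ℓ]ˣ) ⊆ rootsOfUnity i ℤ_[ℓ] := by
      rintro _ ⟨g, rfl⟩
      exact hall g
    have : Finite (rootsOfUnity i ℤ_[ℓ]) := inferInstance
    exact Set.Finite.subset (s := (rootsOfUnity i ℤ_[ℓ] : Set ℤ_[ℓ]ˣ)) this hsub
  have hker : χ.ker.FiniteIndex := inferInstance
  have hclosed : IsClosed (χ.ker : Set Gal(E/K)) := by
    have : (χ.ker : Set Gal(E/K)) = χ ⁻¹' {1} := by ext; simp [MonoidHom.mem_ker]
    rw [this]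
    exact isClosed_singleton.preimage hχ
  have hopen := Subgroup.isOpen_of_isClosed_of_finiteIndex χ.ker hclosed
  set F := IntermediateField.fixedField χ.ker with hF
  have hfix : F.fixingSubgroup = χ.ker := InfiniteGalois.fixingSubgroup_fixedField
    ⟨χ.ker, hclosed⟩
  have hFfin : FiniteDimensional K F := (InfiniteGalois.isOpen_iff_finite F).mp (by
    rw [hfix]; exact hopen)
  have := isLocalRing_integralClosure (R := R) F
  have := finite_integralClosure (R := R) F
  have : FaithfulSMul R (integralClosure R F) := faithfulSMul_integralClosure F
  refine hC.not_forall_isPrimitiveRoot (ResidueField (integralClosure R F)) fun n ↦ ?_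
  obtain ⟨ζ, hζ⟩ := HasEnoughRootsOfUnity.exists_primitiveRoot E (ℓ ^ n)
  have hℓn : IsUnit ((ℓ ^ n : ℕ) : R) := by rw [Nat.cast_pow]; exact hℓ.pow n
  have hζF : ζ ∈ F := by
    rw [hF, IntermediateField.mem_fixedField_iff]
    intro g hg
    have h1 := cyclotomicCharacter.spec ℓ (n := n) g.toRingEquiv ζ hζ.pow_eq_one
    have h2 : cyclotomicCharacter E ℓ g.toRingEquiv = 1 := hg
    rw [h2, Units.val_one, map_one, ZMod.val_one_eq_one_mod, hζ.eq_orderOf, pow_mod_orderOf,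
      pow_one] at h1
    exact h1
  have hζint : IsIntegral R (⟨ζ, hζF⟩ : F) :=
    IsIntegral.of_pow (pow_pos (Fact.out : ℓ.Prime).pos n) (by
      rw [show (⟨ζ, hζF⟩ : F) ^ ℓ ^ n = 1 from Subtype.ext hζ.pow_eq_one]
      exact isIntegral_one)
  let z : integralClosure R F := ⟨⟨ζ, hζF⟩, hζint⟩
  have hz : IsPrimitiveRoot z (ℓ ^ n) :=
    IsPrimitiveRoot.of_map_of_injective (f := (algebraMap F E).comp (algebraMap _ F)) hζ
      ((algebraMap F E).injective.comp Subtype.val_injective)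
  exact ⟨_, hz.quotient_mk (natCast_notMem hℓn (Ideal.IsPrime.ne_top inferInstance))⟩

end RootsOfUnity

/-! ### Stable lattices in `ℓ`-adic representations -/

section Lattice

variable {ℓ : ℕ} [Fact ℓ.Prime]

lemma isOpen_setOf_mapMatrix_toZModPow_eq {G : Type*} [TopologicalSpace G] {d : ℕ}
    {r : G → Matrix (Fin d) (Fin d) ℤ_[ℓ]} (hr : Continuous r) (A : Matrix (Fin d) (Fin d) ℤ_[ℓ])
    (n : ℕ) : IsOpen {g | (PadicInt.toZModPow n).mapMatrix (r g) =
      (PadicInt.toZModPow n).mapMatrix A} := by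
  have h : {g | (PadicInt.toZModPow n).mapMatrix (r g) = (PadicInt.toZModPow n).mapMatrix A} =
      ⋂ (i : Fin d), ⋂ (j : Fin d),
        (fun g ↦ r g i j) ⁻¹' Metric.closedBall (A i j) ((ℓ : ℝ) ^ (-n : ℤ)) := by
    ext g
    simp only [Set.mem_ofPred_eq, Set.mem_iInter, Set.mem_preimage, Metric.mem_closedBall,
      dist_eq_norm, PadicInt.norm_le_pow_iff_mem_span_pow, ← PadicInt.ker_toZModPow,
      RingHom.mem_ker, map_sub, sub_eq_zero, ← Matrix.ext_iff, RingHom.mapMatrix_apply,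
      Matrix.map_apply]
  rw [h]
  refine isOpen_iInter_of_finite fun i ↦ isOpen_iInter_of_finite fun j ↦ ?_
  refine IsOpen.preimage ?_ ?_
  · exact (continuous_apply j).comp ((continuous_apply i).comp hr)
  · refine IsUltrametricDist.isOpen_closedBall _ ?_
    exact (zpow_pos (by exact_mod_cast (Fact.out : ℓ.Prime).pos) _).ne'

/-- The `ℤ_ℓ`-span of the translates of a basis under a compact group is bounded, hence finitely
generated, so it is a stable lattice: the representation has matrix coefficients in `ℤ_ℓ` in a
basis of this lattice. -/
theorem exists_basis_toMatrix_eq_map {G : Type*} [Group G] [TopologicalSpace G] [CompactSpace G]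
    {V : Type*} [AddCommGroup V] [Module ℚ_[ℓ] V] [FiniteDimensional ℚ_[ℓ] V]
    [TopologicalSpace V] [IsModuleTopology ℚ_[ℓ] V] (ρ : Representation ℚ_[ℓ] G V)
    (hρ : Continuous fun x : G × V ↦ ρ x.1 x.2) {d : ℕ} (hd : Module.finrank ℚ_[ℓ] V = d) :
    ∃ (b : Module.Basis (Fin d) ℚ_[ℓ] V) (r : G →* Matrix (Fin d) (Fin d) ℤ_[ℓ]),
      Continuous r ∧
        ∀ g, LinearMap.toMatrix b b (ρ g) = (algebraMap ℤ_[ℓ] ℚ_[ℓ]).mapMatrix (r g) := by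
  let _ : Module ℤ_[ℓ] V := Module.compHom V (algebraMap ℤ_[ℓ] ℚ_[ℓ])
  have htower : IsScalarTower ℤ_[ℓ] ℚ_[ℓ] V :=
    ⟨fun x y v ↦ by rw [Algebra.smul_def, mul_smul]; rfl⟩
  have hsmul : ∀ (c : ℤ_[ℓ]) (v : V), c • v = (c : ℚ_[ℓ]) • v := fun _ _ ↦ rfl
  let b₀ := Module.finBasisOfFinrankEq ℚ_[ℓ] V hd
  have hcont : ∀ (b : Module.Basis (Fin d) ℚ_[ℓ] V) i j,
      Continuous fun g ↦ b.repr (ρ g (b j)) i := by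
    intro b i j
    have h1 : Continuous fun g ↦ ρ g (b j) := hρ.comp (by fun_prop : Continuous fun g ↦ (g, b j))
    exact (IsModuleTopology.continuous_of_linearMap (R := ℚ_[ℓ]) (b.coord i)).comp h1
  obtain ⟨N, hN⟩ : ∃ N : ℕ, ∀ g i j, ‖b₀.repr (ρ g (b₀ j)) i‖ ≤ (ℓ : ℝ) ^ N := by
    choose C hC using fun i j ↦ (isCompact_univ (X := G)).exists_bound_of_continuousOn
      (hcont b₀ i j).continuousOn
    obtain ⟨N, hN⟩ : ∃ N : ℕ, ∀ i j, C i j ≤ (ℓ : ℝ) ^ N := by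
      have hlt : (1 : ℝ) < ℓ := by exact_mod_cast (Fact.out : ℓ.Prime).one_lt
      have h := (tendsto_pow_atTop_atTop_of_one_lt hlt)
      have h2 : ∀ᶠ N : ℕ in Filter.atTop, ∀ i j, C i j ≤ (ℓ : ℝ) ^ N := by
        rw [Filter.eventually_all]
        intro i
        rw [Filter.eventually_all]
        exact fun j ↦ h.eventually_ge_atTop (C i j)
      exact h2.exists
    exact ⟨N, fun g i j ↦ (hC i j g trivial).trans (hN i j)⟩
  have hℓ0 : (ℓ : ℚ_[ℓ]) ≠ 0 := by exact_mod_cast (Fact.out : ℓ.Prime).ne_zero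
  let Λ : Submodule ℤ_[ℓ] V := Submodule.span ℤ_[ℓ] (Set.range fun x : G × Fin d ↦ ρ x.1 (b₀ x.2))
  have hΛle : Λ ≤ Submodule.span ℤ_[ℓ] (Set.range fun i ↦ ((ℓ : ℚ_[ℓ]) ^ N)⁻¹ • b₀ i) := by
    rw [Submodule.span_le]
    rintro _ ⟨⟨g, j⟩, rfl⟩
    show ρ g (b₀ j) ∈ Submodule.span ℤ_[ℓ] _
    rw [← b₀.sum_repr (ρ g (b₀ j))]
    refine Submodule.sum_mem _ fun i _ ↦ ?_
    let c : ℤ_[ℓ] := ⟨(ℓ : ℚ_[ℓ]) ^ N * b₀.repr (ρ g (b₀ j)) i, by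
      have hpos : (0 : ℝ) < (ℓ : ℝ) ^ N := pow_pos (by exact_mod_cast (Fact.out : ℓ.Prime).pos) _
      rw [norm_mul, norm_pow, Padic.norm_p, inv_pow, inv_mul_le_iff₀ hpos, mul_one]
      exact hN g i j⟩
    have hc : b₀.repr (ρ g (b₀ j)) i • b₀ i = c • (((ℓ : ℚ_[ℓ]) ^ N)⁻¹ • b₀ i) := by
      rw [hsmul, smul_smul]
      congr 1
      show _ = (ℓ : ℚ_[ℓ]) ^ N * b₀.repr (ρ g (b₀ j)) i * ((ℓ : ℚ_[ℓ]) ^ N)⁻¹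
      field_simp
    rw [hc]
    exact Submodule.smul_mem _ _ (Submodule.subset_span ⟨i, rfl⟩)
  have hlat : Submodule.IsLattice ℚ_[ℓ] Λ := by
    constructor
    · have : IsNoetherian ℤ_[ℓ]
          (Submodule.span ℤ_[ℓ] (Set.range fun i ↦ ((ℓ : ℚ_[ℓ]) ^ N)⁻¹ • b₀ i)) :=
        isNoetherian_span_of_finite _ (Set.finite_range _)
      exact Submodule.FG.of_le (Submodule.fg_span (Set.finite_range _)) hΛle
    · rw [eq_top_iff, ← b₀.span_eq]
      refine Submodule.span_mono ?_
      rintro _ ⟨j, rfl⟩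
      exact Submodule.subset_span ⟨(1, j), by simp⟩
  have hstable : ∀ g, ∀ v ∈ Λ, ρ g v ∈ Λ := by
    intro g v hv
    induction hv using Submodule.span_induction with
    | mem v hv =>
      obtain ⟨⟨g', j⟩, rfl⟩ := hv
      exact Submodule.subset_span ⟨(g * g', j), by simp⟩
    | zero => simp
    | add v w _ _ hv hw => rw [map_add]; exact Λ.add_mem hv hw
    | smul c v _ hv =>
      have : ρ g (c • v) = c • ρ g v := (ρ g).map_smul_of_tower c v
      rw [this]
      exact Λ.smul_mem c hv
  have hfree : Module.Free ℤ_[ℓ] Λ := Submodule.IsLattice.free ℚ_[ℓ] Λ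
  have hrank : Module.finrank ℤ_[ℓ] Λ = d :=
    (Module.finrank_eq_of_rank_eq ((Submodule.IsLattice.rank' ℚ_[ℓ] Λ).trans
      (by rw [← hd, Module.finrank_eq_rank])))
  let bΛ := Module.finBasisOfFinrankEq ℤ_[ℓ] Λ hrank
  let b := bΛ.extendOfIsLattice ℚ_[ℓ]
  have hb : ∀ j, b j = (bΛ j : V) := fun j ↦ Module.Basis.extendOfIsLattice_apply ..
  have hint : ∀ g i j, ∃ x : ℤ_[ℓ], b.repr (ρ g (b j)) i = x := by
    intro g i j
    have hmem : ρ g (b j) ∈ Λ := hstable g _ (hb j ▸ (bΛ j).2)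
    refine ⟨bΛ.repr ⟨_, hmem⟩ i, ?_⟩
    have h1 : ρ g (b j) = ∑ k, ((bΛ.repr ⟨_, hmem⟩ k : ℤ_[ℓ]) : ℚ_[ℓ]) • b k := by
      have := congrArg Subtype.val (bΛ.sum_repr ⟨_, hmem⟩)
      rw [Submodule.coe_sum] at this
      refine this.symm.trans (Finset.sum_congr rfl fun k _ ↦ ?_)
      rw [hb k]
      rfl
    conv_lhs => rw [h1]
    rw [b.repr_sum_self]
  choose x hx using hint
  have hmat : ∀ g, LinearMap.toMatrix b b (ρ g) =
      (algebraMap ℤ_[ℓ] ℚ_[ℓ]).mapMatrix (Matrix.of (x g)) := by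
    intro g
    ext1 i j
    rw [LinearMap.toMatrix_apply, hx]
    rfl
  have hinj : Function.Injective
      ((algebraMap ℤ_[ℓ] ℚ_[ℓ]).mapMatrix : Matrix (Fin d) (Fin d) ℤ_[ℓ] →+* _) :=
    Matrix.map_injective (IsFractionRing.injective ℤ_[ℓ] ℚ_[ℓ])
  refine ⟨b, ⟨⟨fun g ↦ Matrix.of (x g), ?_⟩, ?_⟩, ?_, hmat⟩
  · apply hinj
    rw [← hmat, map_one ρ, map_one (algebraMap ℤ_[ℓ] ℚ_[ℓ]).mapMatrix]
    exact LinearMap.toMatrix_one b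
  · intro g h
    apply hinj
    show (algebraMap ℤ_[ℓ] ℚ_[ℓ]).mapMatrix (Matrix.of (x (g * h))) = _
    rw [map_mul, ← hmat, ← hmat, ← hmat, map_mul ρ]
    exact LinearMap.toMatrix_mul b _ _
  · refine continuous_pi fun i ↦ continuous_pi fun j ↦ ?_
    have h : Continuous fun g ↦ (x g i j : ℚ_[ℓ]) := by
      simp only [← hx]
      exact hcont b i j
    exact continuous_induced_rng.mpr h

end Lattice

/-! ### Unipotence of the action of inertia -/

section Monodromy

open IsLocalRing

variable {ℓ : ℕ} [Fact ℓ.Prime]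

/-- The reduction modulo `ℓ ^ n` of a group representation by matrices over `ℤ_ℓ`, as a
homomorphism into the general linear group. -/
noncomputable def reductionHom {G : Type*} [Group G] {d : ℕ}
    (r : G →* Matrix (Fin d) (Fin d) ℤ_[ℓ]) (n : ℕ) : G →* GL (Fin d) (ZMod (ℓ ^ n)) :=
  MonoidHom.toHomUnits (((PadicInt.toZModPow n).mapMatrix :
    Matrix (Fin d) (Fin d) ℤ_[ℓ] →+* Matrix (Fin d) (Fin d) (ZMod (ℓ ^ n))).toMonoidHom.comp r)

lemma coe_reductionHom {G : Type*} [Group G] {d : ℕ} (r : G →* Matrix (Fin d) (Fin d) ℤ_[ℓ])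
    (n : ℕ) (g : G) : (reductionHom r n g : Matrix (Fin d) (Fin d) (ZMod (ℓ ^ n))) =
      (PadicInt.toZModPow n).mapMatrix (r g) := rfl

lemma mem_ker_reductionHom {G : Type*} [Group G] {d : ℕ}
    {r : G →* Matrix (Fin d) (Fin d) ℤ_[ℓ]} {n : ℕ} {g : G} :
    g ∈ (reductionHom r n).ker ↔ (PadicInt.toZModPow n).mapMatrix (r g) = 1 := by
  rw [MonoidHom.mem_ker, ← Units.val_inj, coe_reductionHom, Units.val_one]

lemma isOpen_ker_reductionHom {G : Type*} [Group G] [TopologicalSpace G] {d : ℕ}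
    {r : G →* Matrix (Fin d) (Fin d) ℤ_[ℓ]} (hr : Continuous r) (n : ℕ) :
    IsOpen ((reductionHom r n).ker : Set G) := by
  have h := isOpen_setOf_mapMatrix_toZModPow_eq hr 1 n
  rw [map_one] at h
  convert! h using 1
  ext g
  exact mem_ker_reductionHom

/-- The `ℓ ^ n`-th power of a matrix congruent to `1` modulo `ℓ ^ c`, with `c ≥ 1` (and `c ≥ 2` when
`ℓ = 2`), is congruent to `1` modulo `ℓ ^ n`, so the kernel of reduction modulo `ℓ ^ c` has `ℓ`-power exponent modulo `ℓ ^ n`. -/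
lemma pow_mem_ker_reductionHom {G : Type*} [Group G] {d : ℕ}
    {r : G →* Matrix (Fin d) (Fin d) ℤ_[ℓ]} {c : ℕ} (hc : 1 ≤ c) (hc2 : ℓ = 2 → 2 ≤ c) {g : G}
    (hg : g ∈ (reductionHom r c).ker) (n : ℕ) : g ^ ℓ ^ n ∈ (reductionHom r n).ker := by
  rw [mem_ker_reductionHom, ← map_one (PadicInt.toZModPow _).mapMatrix,
    mapMatrix_toZModPow_eq_iff] at hg ⊢
  obtain ⟨B, hB⟩ := hg
  obtain ⟨W, -, hW⟩ := exists_commute_one_add_pow_prime_pow (Fact.out : ℓ.Prime) hc hc2 B n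
  exact ⟨_, by rw [map_pow, hB, hW]⟩

variable {R : Type*} [CommRing R] [IsDomain R] [IsDiscreteValuationRing R]
    [IsAdicComplete (maximalIdeal R) R]
    {K : Type*} [Field K] [Algebra R K] [IsFractionRing R K]
    {E : Type*} [Field E] [Algebra K E] [Algebra R E] [IsScalarTower R K E] [IsSepClosure K E]

/-- The tame relation for the reduction modulo `ℓ ^ n` of an integral `ℓ`-adic representation. -/
lemma mapMatrix_conj_eq_mapMatrix_pow (M : Ideal (integralClosure R E)) [M.IsMaximal]
    (hℓ : IsUnit (ℓ : R)) {d : ℕ} {r : Gal(E/K) →* Matrix (Fin d) (Fin d) ℤ_[ℓ]}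
    (hr : Continuous r) {c : ℕ} (hc : 1 ≤ c) (hc2 : ℓ = 2 → 2 ≤ c) {h : Gal(E/K)}
    (hh : h ∈ inertiaGroup R K E M) (hhc : h ∈ (reductionHom r c).ker) (g : Gal(E/K)) (n a : ℕ)
    (hga : ∀ ζ : E, ζ ^ ℓ ^ n = 1 → g ζ = ζ ^ a) :
    (PadicInt.toZModPow n).mapMatrix (r (g * h * g⁻¹)) =
      (PadicInt.toZModPow n).mapMatrix (r (h ^ a)) := by
  have hk : g * h * g⁻¹ * (h ^ a)⁻¹ ∈ (reductionHom r c).ker :=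
    mul_mem ((MonoidHom.normal_ker _).conj_mem h hhc g) (inv_mem (pow_mem hhc a))
  have hmem := mul_mem_of_tame M (reductionHom r n).ker (isOpen_ker_reductionHom hr n) hh
    (N := ℓ ^ n) (by rw [Nat.cast_pow]; exact hℓ.pow n) hga
    (pow_mem_ker_reductionHom hc hc2 hhc n) (pow_mem_ker_reductionHom hc hc2 hk n)
  rw [MonoidHom.mem_ker, map_mul, map_inv, mul_inv_eq_one] at hmem
  rw [← coe_reductionHom, ← coe_reductionHom, hmem]

/-- Inertia elements congruent to `1` modulo `ℓ ^ c` act unipotently. -/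
theorem isNilpotent_sub_one_of_mem_ker (M : Ideal (integralClosure R E)) [M.IsMaximal]
    (hℓ : IsUnit (ℓ : R)) (hC : ConditionC ℓ (ResidueField R)) {d : ℕ}
    {r : Gal(E/K) →* Matrix (Fin d) (Fin d) ℤ_[ℓ]}
    (hr : Continuous r) {c : ℕ} (hc : 1 ≤ c) (hc2 : ℓ = 2 → 2 ≤ c) {h : Gal(E/K)}
    (hh : h ∈ inertiaGroup R K E M) (hhc : h ∈ (reductionHom r c).ker) :
    IsNilpotent (r h - 1) := by
  have hsep : IsSepClosed E := IsSepClosure.sep_closed K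
  have henough : ∀ n, HasEnoughRootsOfUnity E (ℓ ^ n) := fun n ↦
    hasEnoughRootsOfUnity_of_isUnit (R := R) (by rw [Nat.cast_pow]; exact hℓ.pow n)
  refine isNilpotent_sub_one_of_conj_eq_pow hc hc2 (r h) (mem_ker_reductionHom.mp hhc)
    fun i hi ↦ ?_
  obtain ⟨g, hg⟩ := exists_cyclotomicCharacter_pow_ne_one (K := K) (E := E) hℓ hC hi
  refine ⟨r.toHomUnits g, cyclotomicCharacter E ℓ g.toRingEquiv, hg, fun n ↦ ?_⟩
  have := mapMatrix_conj_eq_mapMatrix_pow M hℓ hr hc hc2 hh hhc g n _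
    fun ζ hζ ↦ cyclotomicCharacter.spec ℓ (n := n) g.toRingEquiv ζ hζ
  rw [map_mul r, map_mul r, map_pow r] at this
  rw [← map_inv]
  exact this

/-- Inertia elements congruent to `1` modulo `ℓ ^ c` act by matrices commuting with those of all
inertia elements, since inertia fixes the roots of unity of `ℓ`-power order. -/
theorem commute_of_mem_ker (M : Ideal (integralClosure R E)) [M.IsMaximal]
    (hℓ : IsUnit (ℓ : R)) {d : ℕ} {r : Gal(E/K) →* Matrix (Fin d) (Fin d) ℤ_[ℓ]}
    (hr : Continuous r) {c : ℕ} (hc : 1 ≤ c) (hc2 : ℓ = 2 → 2 ≤ c) {h s : Gal(E/K)}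
    (hh : h ∈ inertiaGroup R K E M) (hhc : h ∈ (reductionHom r c).ker)
    (hs : s ∈ inertiaGroup R K E M) : Commute (r h) (r s) := by
  have h1 : r (s * h * s⁻¹) = r h := by
    ext1 i j
    refine PadicInt.ext_of_toZModPow.mp fun n ↦ ?_
    have := mapMatrix_conj_eq_mapMatrix_pow M hℓ hr hc hc2 hh hhc s n 1 fun ζ hζ ↦ by
      rw [pow_one]
      exact apply_eq_self_of_mem_inertiaGroup (Ideal.IsMaximal.ne_top ‹_›) hs
        (by rw [Nat.cast_pow]; exact hℓ.pow n) hζ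
    rw [pow_one] at this
    exact congrFun (congrFun this i) j
  show r h * r s = r s * r h
  calc r h * r s = r (s * h * s⁻¹) * r s := by rw [h1]
    _ = r s * r h := by rw [← map_mul, inv_mul_cancel_right, map_mul]

end Monodromy

/-- `K` is a complete discrete valuation field with valuation ring `R` and perfect residue field
satisfying `(C_ℓ)`, `Ksep` is a separable closure of `K`, and `M` is the maximal ideal of the
ring of integers of `Ksep`. -/
theorem mainTheorem2
    {R : Type*} [CommRing R] [IsDomain R] [IsDiscreteValuationRing R]
    [IsAdicComplete (IsLocalRing.maximalIdeal R) R]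
    {K : Type*} [Field K] [Algebra R K] [IsFractionRing R K]
    {Ksep : Type*} [Field Ksep] [Algebra K Ksep] [IsSepClosure K Ksep]
    [Algebra R Ksep] [IsScalarTower R K Ksep]
    (M : Ideal (integralClosure R Ksep)) [M.IsMaximal]
    [PerfectField (IsLocalRing.ResidueField R)]
    (ℓ : ℕ) [Fact ℓ.Prime] (hℓ : ℓ ≠ ringChar (IsLocalRing.ResidueField R))
    (hC : ConditionC ℓ (IsLocalRing.ResidueField R))
    {V : Type*} [AddCommGroup V] [Module ℚ_[ℓ] V] [FiniteDimensional ℚ_[ℓ] V]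
    [TopologicalSpace V] [IsModuleTopology ℚ_[ℓ] V]
    (ρ : Representation ℚ_[ℓ] Gal(Ksep/K) V)
    (hρ : Continuous fun x : Gal(Ksep/K) × V => ρ x.1 x.2)
    (d : ℕ) (hd : Module.finrank ℚ_[ℓ] V = d) :
    {s : inertiaGroup R K Ksep M | IsUnipotentEnd (ρ (s : Gal(Ksep/K)))} =
      {s : inertiaGroup R K Ksep M | LinearMap.trace ℚ_[ℓ] V (ρ (s : Gal(Ksep/K))) = (d : ℚ_[ℓ])} ∧
    ∃ I : Subgroup (inertiaGroup R K Ksep M),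
      (I : Set (inertiaGroup R K Ksep M)) =
        {s : inertiaGroup R K Ksep M | IsUnipotentEnd (ρ (s : Gal(Ksep/K)))} ∧
      IsOpen (I : Set (inertiaGroup R K Ksep M)) ∧
      I.index ∣ monodromyBound ℓ d := by
  have hℓR : IsUnit (ℓ : R) := isUnit_natCast_of_ne_ringChar hℓ
  have hgal : IsGalois K Ksep := inferInstance
  obtain ⟨b, r, hr, hbr⟩ := exists_basis_toMatrix_eq_map ρ hρ hd
  -- reduction modulo `ℓ ^ c` is reduction modulo `ℓ`, or modulo `4` if `ℓ = 2`
  obtain ⟨c, hc, hc2, hcard⟩ : ∃ c : ℕ, 1 ≤ c ∧ (ℓ = 2 → 2 ≤ c) ∧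
      monodromyBound ℓ d = Nat.card (GL (Fin d) (ZMod (ℓ ^ c))) := by
    by_cases h2 : ℓ = 2
    · subst h2
      exact ⟨2, by norm_num, fun _ ↦ le_rfl, by
        rw [monodromyBound, if_pos rfl, show (2 : ℕ) ^ 2 = 4 from rfl]⟩
    · exact ⟨1, le_rfl, fun h ↦ absurd h h2, by rw [monodromyBound, if_neg h2, pow_one]⟩
  let Φ : Matrix (Fin d) (Fin d) ℤ_[ℓ] →+* Module.End ℚ_[ℓ] V :=
    (LinearMap.toMatrixAlgEquiv b).symm.toRingHom.comp (algebraMap ℤ_[ℓ] ℚ_[ℓ]).mapMatrix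
  have hΦ : ∀ g, ρ g = Φ (r g) := by
    intro g
    apply (LinearMap.toMatrixAlgEquiv b).injective
    show LinearMap.toMatrixAlgEquiv b (ρ g) =
      LinearMap.toMatrixAlgEquiv b ((LinearMap.toMatrixAlgEquiv b).symm _)
    rw [AlgEquiv.apply_symm_apply]
    exact hbr g
  let ρI : inertiaGroup R K Ksep M →* Module.End ℚ_[ℓ] V := ρ.comp (Subgroup.subtype _)
  let κ : inertiaGroup R K Ksep M →* GL (Fin d) (ZMod (ℓ ^ c)) :=
    (reductionHom r c).comp (Subgroup.subtype _)
  have hnil : ∀ h ∈ κ.ker, IsNilpotent (ρI h - 1) := by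
    intro h hh
    have := (isNilpotent_sub_one_of_mem_ker M hℓR hC hr hc hc2 h.2 hh).map Φ
    rw [map_sub, map_one, ← hΦ] at this
    exact this
  have hcomm : ∀ h ∈ κ.ker, ∀ s, Commute (ρI h) (ρI s) := by
    intro h hh s
    have := (commute_of_mem_ker M hℓR hr hc hc2 h.2 hh s.2).map Φ
    rw [← hΦ, ← hΦ] at this
    exact this
  have hNeZero : NeZero (ℓ ^ c) := ⟨pow_ne_zero _ (Fact.out : ℓ.Prime).ne_zero⟩
  have hfinite : κ.ker.FiniteIndex := inferInstance
  let I := unipotentSubgroup ℚ_[ℓ] ρI κ.ker hcomm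
  have hle : κ.ker ≤ I := hnil
  refine ⟨?_, I, rfl, ?_, ?_⟩
  · ext s
    constructor
    · intro hs
      show LinearMap.trace ℚ_[ℓ] V (ρI s) = d
      rw [← hd]
      exact trace_eq_finrank_of_isNilpotent_sub_one hs
    · intro (hs : LinearMap.trace ℚ_[ℓ] V (ρI s) = d)
      obtain ⟨n, hn, -, hmem⟩ := Subgroup.exists_pow_mem_of_index_ne_zero
        (Subgroup.FiniteIndex.index_ne_zero (H := κ.ker)) s
      refine isNilpotent_sub_one_of_trace_eq_finrank (ρI s) hn.ne' ?_ (hs.trans (by rw [hd]))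
      rw [← map_pow]
      exact hnil _ hmem
  · refine Subgroup.isOpen_mono hle ?_
    exact (isOpen_ker_reductionHom hr c).preimage continuous_subtype_val
  · rw [hcard]
    refine (Subgroup.index_dvd_of_le hle).trans ?_
    rw [Subgroup.index_ker]
    exact Subgroup.card_subgroup_dvd_card _
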